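/- Let $L^2=L^2([0,2\pi],\mathbb C^2)$ and put $$J_2=\begin{pmatrix}0&-1\\1&0\end{pmatrix},\qquad \mathcal N=\begin{pmatrix}1&0\\0&-1\end{pmatrix},\qquad r_e(\theta)=\frac1{1+e\cos\theta}.$$ For $e\in[0,1)$, $\omega\in\mathbb C$ with $|\omega|=1$, and $\alpha,\beta\ge 0$, let $\mathcal A(\alpha,\beta,e)$ be the operator $$\mathcal A(\alpha,\beta,e)=-\frac{d^2}{d\theta^2}I_2-2J_2\frac{d}{d\theta}+r_e(\theta)\bigl((1+\alpha)I_2+\beta\,\mathcal N\bigr)$$ in $L^2$ with domain $$\bar D_2(\omega,2\pi)=\{y\in W^{2,2}([0,2\pi],\mathbb C^2) : y(2\pi)=\omega y(0),\ \dot y(2\pi)=\omega\dot y(0)\}.$$ Its $\omega$-Morse index $\phi_\omega(\mathcal A(\alpha,\beta,e))$ is the total number of its negative eigenvalues, counted with multiplicity. We write $\mathcal A(\alpha,\beta,e)\ge 0$ if $\mathcal A(\alpha,\beta,e)$ has no negative eigenvalue, and $\mathcal A(\alpha,\beta,e)>0$ if it is positive definite, i.e. $\langle \mathcal A(\alpha,\beta,e)y,y\rangle_{L^2}>0$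 for every nonzero $y\in\bar D_2(\omega,2\pi)$. **Proposition 3.2.** Fix $e\in[0,1)$ and $\omega\in\mathbb C$ with $|\omega|=1$. 1. For every $\beta\ge 0$, the index $\phi_\omega(\mathcal A(\alpha,\beta,e))$ is nonincreasing in $\alpha\in[0,+\infty)$. 2. For every $\alpha\ge 0$, the index $\phi_\omega(\mathcal A(\alpha,\beta,e))$ is nondecreasing in $\beta\in(0,+\infty)$. 3. If $\alpha>0$, $\beta_2>\beta_1>0$ and $\mathcal A(\alpha,\beta_2,e)\ge 0$, then $\mathcal A(\alpha,\beta_1,e)>0$. -/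

import Mathlib

open MeasureTheory Set

noncomputable section

namespace CriteriaOperator

/-- The complex plane `ℂ²` with its Hermitian inner product. -/
abbrev E2 : Type := EuclideanSpace ℂ (Fin 2)

/-- Lebesgue measure on `[0, 2π]`. -/
abbrev mu : Measure ℝ := volume.restrict (Icc 0 (2 * Real.pi))

/-- The Hilbert space `L²([0, 2π], ℂ²)`. -/
abbrev L2 : Type := Lp E2 2 mu

/-- `J₂ = (0 -1; 1 0)`. -/
def J2 : Matrix (Fin 2) (Fin 2) ℂ := !![0, -1; 1, 0]

/-- `𝒩 = diag(1, -1)`. -/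
def N2 : Matrix (Fin 2) (Fin 2) ℂ := !![1, 0; 0, -1]

/-- `R_{α,β} = (1 + α) I₂ + β 𝒩`. -/
def Rmat (α β : ℝ) : Matrix (Fin 2) (Fin 2) ℂ :=
  ((1 + α : ℝ) : ℂ) • (1 : Matrix (Fin 2) (Fin 2) ℂ) + (β : ℂ) • N2

/-- `r_e(θ) = (1 + e cos θ)⁻¹`. -/
def rE (e θ : ℝ) : ℝ := (1 + e * Real.cos θ)⁻¹

/-- The action of a `2 × 2` matrix on `ℂ²`. -/
abbrev act (M : Matrix (Fin 2) (Fin 2) ℂ) (v : E2) : E2 := Matrix.toEuclideanCLM (𝕜 := ℂ) M v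

/-- `y ∈ W^{2,2}([0, 2π], ℂ²)` (in its `C¹` representative) with derivatives `ẏ = y₁`, `ÿ = y₂`:
`y₂` is square integrable on `[0, 2π]`, and there `y₁` is a primitive of `y₂` and `y` is a
primitive of `y₁`. -/
structure IsW22 (y y₁ y₂ : ℝ → E2) : Prop where
  memLp : MemLp y₂ 2 mu
  deriv₁ : ∀ t ∈ Icc (0 : ℝ) (2 * Real.pi), y₁ t = y₁ 0 + ∫ s in (0 : ℝ)..t, y₂ s
  deriv₀ : ∀ t ∈ Icc (0 : ℝ) (2 * Real.pi), y t = y 0 + ∫ s in (0 : ℝ)..t, y₁ s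

/-- `y ∈ D̄₂(ω, 2π)`: `y ∈ W^{2,2}([0, 2π], ℂ²)` with `y(2π) = ω y(0)` and `ẏ(2π) = ω ẏ(0)`. -/
structure InDomain (ω : ℂ) (y y₁ y₂ : ℝ → E2) : Prop extends IsW22 y y₁ y₂ where
  bdry₀ : y (2 * Real.pi) = ω • y 0
  bdry₁ : y₁ (2 * Real.pi) = ω • y₁ 0

/-- The differential expression `-ÿ - 2 J₂ ẏ + r_e(θ) R y` at the point `t`. -/
def expr (R : Matrix (Fin 2) (Fin 2) ℂ) (e : ℝ) (y y₁ y₂ : ℝ → E2) (t : ℝ) : E2 :=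
  -y₂ t - (2 : ℂ) • act J2 (y₁ t) + ((rE e t : ℝ) : ℂ) • act R (y t)

lemma IsW22.intervalIntegrable {y y₁ y₂ : ℝ → E2} (h : IsW22 y y₁ y₂) :
    IntervalIntegrable y₂ volume 0 (2 * Real.pi) := by
  rw [intervalIntegrable_iff_integrableOn_Icc_of_le Real.two_pi_pos.le]
  exact h.memLp.integrable (by norm_num)

lemma continuousOn_of_primitive {f g : ℝ → E2} (c : E2)
    (hg : IntervalIntegrable g volume 0 (2 * Real.pi))
    (h : ∀ t ∈ Icc (0 : ℝ) (2 * Real.pi), f t = c + ∫ s in (0 : ℝ)..t, g s) :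
    ContinuousOn f (Icc 0 (2 * Real.pi)) := by
  have h1 := intervalIntegral.continuousOn_primitive_interval' hg left_mem_uIcc
  rw [uIcc_of_le Real.two_pi_pos.le] at h1
  exact (continuousOn_const.add h1).congr h

lemma IsW22.continuousOn₁ {y y₁ y₂ : ℝ → E2} (h : IsW22 y y₁ y₂) :
    ContinuousOn y₁ (Icc 0 (2 * Real.pi)) :=
  continuousOn_of_primitive _ h.intervalIntegrable h.deriv₁

lemma IsW22.intervalIntegrable₁ {y y₁ y₂ : ℝ → E2} (h : IsW22 y y₁ y₂) :
    IntervalIntegrable y₁ volume 0 (2 * Real.pi) := by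
  apply ContinuousOn.intervalIntegrable
  rw [uIcc_of_le Real.two_pi_pos.le]
  exact h.continuousOn₁

lemma IsW22.continuousOn₀ {y y₁ y₂ : ℝ → E2} (h : IsW22 y y₁ y₂) :
    ContinuousOn y (Icc 0 (2 * Real.pi)) :=
  continuousOn_of_primitive _ h.intervalIntegrable₁ h.deriv₀

lemma InDomain.add {ω : ℂ} {y y₁ y₂ z z₁ z₂ : ℝ → E2} (hy : InDomain ω y y₁ y₂)
    (hz : InDomain ω z z₁ z₂) : InDomain ω (y + z) (y₁ + z₁) (y₂ + z₂) where
  memLp := hy.memLp.add hz.memLp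
  deriv₁ t ht := by
    have hsub : uIcc 0 t ⊆ uIcc 0 (2 * Real.pi) :=
      uIcc_subset_uIcc_left (by rw [uIcc_of_le Real.two_pi_pos.le]; exact ht)
    simp only [Pi.add_apply]
    rw [intervalIntegral.integral_add (hy.intervalIntegrable.mono_set hsub)
      (hz.intervalIntegrable.mono_set hsub), hy.deriv₁ t ht, hz.deriv₁ t ht]
    abel
  deriv₀ t ht := by
    have hsub : uIcc 0 t ⊆ uIcc 0 (2 * Real.pi) :=
      uIcc_subset_uIcc_left (by rw [uIcc_of_le Real.two_pi_pos.le]; exact ht)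
    simp only [Pi.add_apply]
    rw [intervalIntegral.integral_add (hy.intervalIntegrable₁.mono_set hsub)
      (hz.intervalIntegrable₁.mono_set hsub), hy.deriv₀ t ht, hz.deriv₀ t ht]
    abel
  bdry₀ := by simp [hy.bdry₀, hz.bdry₀]
  bdry₁ := by simp [hy.bdry₁, hz.bdry₁]

lemma InDomain.smul {ω : ℂ} {y y₁ y₂ : ℝ → E2} (c : ℂ) (hy : InDomain ω y y₁ y₂) :
    InDomain ω (c • y) (c • y₁) (c • y₂) where
  memLp := hy.memLp.const_smul c
  deriv₁ t ht := by
    simp only [Pi.smul_apply, intervalIntegral.integral_smul]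
    rw [hy.deriv₁ t ht, smul_add]
  deriv₀ t ht := by
    simp only [Pi.smul_apply, intervalIntegral.integral_smul]
    rw [hy.deriv₀ t ht, smul_add]
  bdry₀ := by simp [hy.bdry₀, smul_comm c ω]
  bdry₁ := by simp [hy.bdry₁, smul_comm c ω]

lemma InDomain.zero (ω : ℂ) : InDomain ω 0 0 0 where
  memLp := MemLp.zero
  deriv₁ t _ := by simp
  deriv₀ t _ := by simp
  bdry₀ := by simp
  bdry₁ := by simp

/-- The graph of `𝒜(R, e)` on the domain `D̄₂(ω, 2π)`: all pairs `(y, -ÿ - 2 J₂ ẏ + r_e R y)` in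
`L² × L²` with `y ∈ D̄₂(ω, 2π)`. -/
def graphA (R : Matrix (Fin 2) (Fin 2) ℂ) (e : ℝ) (ω : ℂ) : Submodule ℂ (L2 × L2) where
  carrier := {p | ∃ y y₁ y₂ : ℝ → E2, InDomain ω y y₁ y₂ ∧ p.1 =ᵐ[mu] y ∧
    p.2 =ᵐ[mu] expr R e y y₁ y₂}
  zero_mem' := ⟨0, 0, 0, InDomain.zero ω, Lp.coeFn_zero _ _ _, by
    filter_upwards [Lp.coeFn_zero E2 2 mu] with t ht
    simpa [expr] using ht⟩
  add_mem' := by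
    rintro p q ⟨y, y₁, y₂, hy, hp, hp'⟩ ⟨z, z₁, z₂, hz, hq, hq'⟩
    refine ⟨_, _, _, hy.add hz, ?_, ?_⟩
    · exact (Lp.coeFn_add p.1 q.1).trans (hp.add hq)
    · refine (Lp.coeFn_add p.2 q.2).trans ((hp'.add hq').trans (Filter.Eventually.of_forall ?_))
      intro t
      simp only [expr, act, Pi.add_apply, map_add, smul_add]
      abel
  smul_mem' := by
    rintro c p ⟨y, y₁, y₂, hy, hp, hp'⟩
    refine ⟨_, _, _, hy.smul c, ?_, ?_⟩
    · exact (Lp.coeFn_smul c p.1).trans (hp.const_smul c)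
    · refine (Lp.coeFn_smul c p.2).trans
        ((hp'.const_smul c).trans (Filter.Eventually.of_forall ?_))
      intro t
      simp only [expr, act, Pi.smul_apply, map_smul, smul_add, smul_sub, smul_neg]
      rw [smul_comm c (2 : ℂ), smul_comm c ((rE e t : ℝ) : ℂ)]

lemma ae_zero_of_primitive_zero {f : ℝ → E2} (hf : IntervalIntegrable f volume 0 (2 * Real.pi))
    (h : ∀ t ∈ Icc (0 : ℝ) (2 * Real.pi), ∫ s in (0 : ℝ)..t, f s = 0) : f =ᵐ[mu] 0 := by
  have h1 := hf.ae_hasDerivAt_integral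
  have h2 : ∀ᵐ t ∂mu, t ∈ Ioo (0 : ℝ) (2 * Real.pi) := by
    rw [mu, restrict_Ioo_eq_restrict_Icc.symm]
    exact ae_restrict_mem measurableSet_Ioo
  filter_upwards [ae_restrict_of_ae h1, h2] with t ht ht2
  have h3 := ht (by rw [uIcc_of_le Real.two_pi_pos.le]; exact Ioo_subset_Icc_self ht2) 0
    left_mem_uIcc
  have h4 : (fun x => ∫ s in (0 : ℝ)..x, f s) =ᶠ[nhds t] fun _ => 0 := by
    filter_upwards [Ioo_mem_nhds ht2.1 ht2.2] with x hx
    exact h x (Ioo_subset_Icc_self hx)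
  exact h3.unique ((hasDerivAt_const t (0 : E2)).congr_of_eventuallyEq h4)

/-- The graph is single-valued, so that it is the graph of an operator. -/
lemma graphA_singleValued (R : Matrix (Fin 2) (Fin 2) ℂ) (e : ℝ) (ω : ℂ) :
    ∀ p ∈ graphA R e ω, p.1 = 0 → p.2 = 0 := by
  rintro p ⟨y, y₁, y₂, hy, hp, hp'⟩ h0
  have key : ∀ {g : ℝ → E2}, ContinuousOn g (Icc 0 (2 * Real.pi)) → g =ᵐ[mu] 0 →
      ∀ t ∈ Icc (0 : ℝ) (2 * Real.pi), g t = 0 := fun hg h =>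
    Measure.eqOn_Icc_of_ae_eq volume Real.two_pi_pos.ne h hg continuousOn_const
  have mem0 : (0 : ℝ) ∈ Icc (0 : ℝ) (2 * Real.pi) := ⟨le_rfl, Real.two_pi_pos.le⟩
  have hy0 : y =ᵐ[mu] 0 := by
    rw [h0] at hp
    exact hp.symm.trans (Lp.coeFn_zero _ _ _)
  have e0 := key hy.continuousOn₀ hy0
  have hy1 : y₁ =ᵐ[mu] 0 := ae_zero_of_primitive_zero hy.intervalIntegrable₁ fun t ht => by
    have := hy.deriv₀ t ht
    rw [e0 t ht, e0 0 mem0, zero_add] at this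
    exact this.symm
  have e1 := key hy.continuousOn₁ hy1
  have hy2 : y₂ =ᵐ[mu] 0 := ae_zero_of_primitive_zero hy.intervalIntegrable fun t ht => by
    have := hy.deriv₁ t ht
    rw [e1 t ht, e1 0 mem0, zero_add] at this
    exact this.symm
  apply Lp.ext
  filter_upwards [hp', hy0, hy1, hy2, Lp.coeFn_zero E2 2 mu] with t a b c d f
  rw [a, f]
  simp [expr, b, c, d]

/-- The operator `𝒜(R, e) = -d²/dθ² - 2 J₂ d/dθ + r_e(θ) R` in `L²([0, 2π], ℂ²)` with domain
`D̄₂(ω, 2π)`. -/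
def opR (R : Matrix (Fin 2) (Fin 2) ℂ) (e : ℝ) (ω : ℂ) : L2 →ₗ.[ℂ] L2 :=
  (graphA R e ω).toLinearPMap

/-- The graph of the operator is the prescribed one. -/
lemma graph_opR (R : Matrix (Fin 2) (Fin 2) ℂ) (e : ℝ) (ω : ℂ) :
    (opR R e ω).graph = graphA R e ω :=
  Submodule.toLinearPMap_graph_eq _ (graphA_singleValued R e ω)

/-- For `0 ≤ e < 1` the domain of the operator is the whole of `D̄₂(ω, 2π)`. -/
lemma mem_domain_opR (R : Matrix (Fin 2) (Fin 2) ℂ) {e : ℝ} (he₀ : 0 ≤ e) (he₁ : e < 1) (ω : ℂ)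
    (u : L2) : u ∈ (opR R e ω).domain ↔
      ∃ y y₁ y₂ : ℝ → E2, InDomain ω y y₁ y₂ ∧ u =ᵐ[mu] y := by
  constructor
  · rintro ⟨p, ⟨y, y₁, y₂, hy, hp, -⟩, rfl⟩
    exact ⟨y, y₁, y₂, hy, hp⟩
  · rintro ⟨y, y₁, y₂, hy, hu⟩
    have hcont : ∀ {g : ℝ → E2}, ContinuousOn g (Icc 0 (2 * Real.pi)) → MemLp g 2 mu := by
      intro g hg
      obtain ⟨C, hC⟩ := isCompact_Icc.exists_bound_of_continuousOn hg
      refine MemLp.of_bound (hg.aestronglyMeasurable measurableSet_Icc) C ?_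
      filter_upwards [ae_restrict_mem measurableSet_Icc] with t ht using hC t ht
    have hpos : ∀ t : ℝ, 1 + e * Real.cos t ≠ 0 := fun t => by
      nlinarith [Real.neg_one_le_cos t, mul_le_mul_of_nonneg_left (Real.neg_one_le_cos t) he₀]
    have hre : Continuous fun t => ((rE e t : ℝ) : ℂ) := by
      refine Complex.continuous_ofReal.comp (Continuous.inv₀ (by fun_prop) hpos)
    have hL : MemLp (expr R e y y₁ y₂) 2 mu := by
      refine (hy.memLp.neg.sub ?_).add ?_
      · refine hcont (g := fun t => (2 : ℂ) • act J2 (y₁ t)) (ContinuousOn.fun_const_smul ?_ _)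
        exact (Matrix.toEuclideanCLM (𝕜 := ℂ) J2).continuous.comp_continuousOn hy.continuousOn₁
      · refine hcont (hre.continuousOn.smul ?_)
        exact (Matrix.toEuclideanCLM (𝕜 := ℂ) R).continuous.comp_continuousOn hy.continuousOn₀
    exact ⟨(u, hL.toLp _), ⟨y, y₁, y₂, hy, hu, hL.coeFn_toLp⟩, rfl⟩

/-- The criteria operator `𝒜(α, β, e) = 𝒜(R_{α,β}, e)` with domain `D̄₂(ω, 2π)`. -/
def op (α β e : ℝ) (ω : ℂ) : L2 →ₗ.[ℂ] L2 := opR (Rmat α β) e ω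

/-- The eigenspace `ker (A - lam)` of an operator `A` in `L²`; `lam` is an eigenvalue if and only if
it is not `⊥`. -/
def eigenspace (A : L2 →ₗ.[ℂ] L2) (lam : ℝ) : Submodule ℂ A.domain :=
  LinearMap.ker (A.toFun - (lam : ℂ) • A.domain.subtype)

/-- The total number of negative eigenvalues of `A`, counted with multiplicity. It is valued in
`ℕ∞`: the supremum, over all finite sets of negative numbers, of the sum of the dimensions of the
eigenspaces. -/
def morseIndex (A : L2 →ₗ.[ℂ] L2) : ℕ∞ :=
  ⨆ s : Finset (Iio (0 : ℝ)), ∑ lam ∈ s, Cardinal.toENat (Module.rank ℂ (eigenspace A lam))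

/-- `A ≥ 0`: the operator `A` possesses no negative eigenvalues. -/
def NonNeg (A : L2 →ₗ.[ℂ] L2) : Prop :=
  ∀ lam : ℝ, lam < 0 → eigenspace A lam = ⊥

/-- `A > 0`: the operator `A` is positive definite, `⟨A y, y⟩ > 0` for all `y ≠ 0` in the domain
(that is, `⟨A y, y⟩` is real and positive). -/
def PosDef (A : L2 →ₗ.[ℂ] L2) : Prop :=
  ∀ y : A.domain, y ≠ 0 → 0 < (inner ℂ (A y) (y : L2)).re ∧ (inner ℂ (A y) (y : L2)).im = 0

end CriteriaOperator

end

/-! The quadratic form can be written explicitly. With `q = qE e` the logarithmic derivative of `1 +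
e cos θ`, the Riccati identity `q' = r_e - 1 - q²` and integration by parts give, on the domain, `⟨𝒜
y, y⟩ = ∫ |ẏ + J₂ y - q y|² + α ∫ r_e |y|² + β ∫ r_e (|y₀|² - |y₁|²)`. All boundary terms vanish
because `|ω| = 1` and `q` is zero at both endpoints (`inner_expr`, `InDomain.integral_expr`). So the
form is `Q + α ρ + β σ` with `Q ≥ 0`, `ρ > 0` for `y ≠ 0`, `|σ| ≤ ρ`, and these coefficients, like
the domain, do not depend on `α, β` (`exists_form_eq`, `mem_domain_op`).

Lowering `α` can only lower the form. If `α, β ≥ 0` and the form is negative, then `σ < 0`, so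
raising `β` keeps it negative. If `α > 0` and the form is nonnegative at `β₂`, it is positive at `0
< β₁ < β₂`: for `σ ≥ 0` because `α ρ > 0`, for `σ < 0` because `β₁ σ > β₂ σ`.

Passing from forms to eigenvalue counts uses the variational principle: the Morse index bounds the
dimension of every negative definite subspace (`HasCompactResolvent.finrank_le_morseIndex`), and the
negative eigenspaces give such subspaces (`HasCompactResolvent.exists_negDefOn`). Its core is
`HasCompactResolvent.form_nonneg_of_mem_orthogonal`: the form is nonnegative orthogonally to the
negative eigenvectors. This needs `A + c` to have a compact inverse, obtained by turning the
boundary value problem into an equation `(1 + C) p = (-f, 0)` with `C` compact on the space of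
Cauchy data (`exists_resolvent`). -/

noncomputable section

namespace CriteriaOperator

/-! ### Symmetric operators with compact resolvent: nonnegativity off the negative eigenvectors -/

section Abstract

variable {H : Type*} [NormedAddCommGroup H] [InnerProductSpace ℂ H]

/-- `A` is a symmetric operator with `A + c > 0`, and `K` is a compact right inverse of `A + c`. -/
structure HasCompactResolvent (A : H →ₗ.[ℂ] H) (c : ℝ) (K : H →L[ℂ] H) : Prop where
  symm : ∀ x y : A.domain, inner ℂ (A x) (y : H) = inner ℂ (x : H) (A y)
  pos : 0 < c
  coercive : ∀ x : A.domain, x ≠ 0 → 0 < (inner ℂ (A x) (x : H)).re + c * ‖(x : H)‖ ^ 2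
  compact : IsCompactOperator K
  right_inv : ∀ f, ∃ x : A.domain, (x : H) = K f ∧ A x = f - (c : ℂ) • K f

/-- The span of the eigenvectors of `A` with negative eigenvalue. -/
def negSpan (A : H →ₗ.[ℂ] H) : Submodule ℂ H :=
  Submodule.span ℂ {w | ∃ x : A.domain, (x : H) = w ∧ ∃ lam : ℝ, lam < 0 ∧ A x = (lam : ℂ) • (x : H)}

lemma mem_negSpan_orthogonal {A : H →ₗ.[ℂ] H} {f : H}
    (hf : ∀ (x : A.domain) (lam : ℝ), lam < 0 → A x = (lam : ℂ) • (x : H) →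
      inner ℂ (x : H) f = 0) : f ∈ (negSpan A)ᗮ := by
  rw [Submodule.mem_orthogonal]
  intro u hu
  induction hu using Submodule.span_induction with
  | mem u hu =>
    obtain ⟨x, rfl, lam, hlam, hx⟩ := hu
    exact hf x lam hlam hx
  | zero => simp
  | add u v _ _ hu hv => rw [inner_add_left, hu, hv, add_zero]
  | smul a u _ hu => rw [inner_smul_left, hu, mul_zero]

/-- If the nonzero eigenvalues `κ` of a compact symmetric operator `S` satisfy `c κ² ≤ κ`, then
`S - c S² ≥ 0`. -/
lemma IsCompactOperator.form_nonneg [CompleteSpace H] {S : H →L[ℂ] H} (hc : IsCompactOperator S)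
    (hs : S.IsSymmetric) (c : ℝ)
    (hev : ∀ (κ : ℝ) (v : H), κ ≠ 0 → v ≠ 0 → S v = (κ : ℂ) • v → 0 ≤ κ - c * κ ^ 2) (f : H) :
    0 ≤ (inner ℂ (f - (c : ℂ) • S f) (S f)).re := by
  -- The polynomial vanishes at `0`, so only nonzero spectral points matter, and for a compact
  -- operator these are eigenvalues. The continuous functional calculus then turns the scalar
  -- inequality into an operator inequality.
  have hspec : ∀ κ ∈ spectrum ℝ S, 0 ≤ κ - c * κ ^ 2 := by
    intro κ hκ
    rcases eq_or_ne κ 0 with rfl | hne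
    · simp
    have hκ' : (κ : ℂ) ∈ spectrum ℂ S := spectrum.algebraMap_mem ℂ hκ
    have hneC : (κ : ℂ) ≠ 0 := by exact_mod_cast hne
    obtain ⟨v, hv, hv0⟩ := ((hc.hasEigenvalue_iff_mem_spectrum hneC).2 hκ').exists_hasEigenvector
    rw [Module.End.mem_genEigenspace_one] at hv
    exact hev κ v hne hv0 hv
  have hSa : IsSelfAdjoint S := hs.isSelfAdjoint
  have hP : (0 : H →L[ℂ] H) ≤ S - c • S ^ 2 := by
    have h1 := cfc_nonneg (R := ℝ) (a := S) (f := fun κ : ℝ => κ - c * κ ^ 2) hspec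
    rw [cfc_sub (fun κ : ℝ => κ) (fun κ : ℝ => c * κ ^ 2) S (by fun_prop) (by fun_prop),
      cfc_const_mul c (fun κ : ℝ => κ ^ 2) S (by fun_prop), cfc_pow_id S 2, cfc_id' ℝ S] at h1
    exact h1
  rw [ContinuousLinearMap.nonneg_iff_isPositive] at hP
  have h2 := hP.re_inner_nonneg_left f
  have h3 : inner ℂ ((S - c • S ^ 2) f) f = inner ℂ (f - (c : ℂ) • S f) (S f) := by
    have hs' : ∀ x y, inner ℂ (S x) y = inner ℂ x (S y) := fun x y => hs x y
    have : (S - c • S ^ 2) f = S f - (c : ℂ) • S (S f) := by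
      simp [pow_two]
    rw [this, inner_sub_left, inner_sub_left, inner_smul_left, inner_smul_left, hs', hs']
  rw [h3] at h2
  exact h2

namespace HasCompactResolvent

variable {A : H →ₗ.[ℂ] H} {c : ℝ} {K : H →L[ℂ] H}

/-- Coercivity excludes the eigenvalue `-c`; this is the injectivity of `A + c`. -/
lemma eq_zero_of_eigen (h : HasCompactResolvent A c K) {x : A.domain}
    (hx : A x = -(c : ℂ) • (x : H)) : x = 0 := by
  by_contra hne
  have := h.coercive x hne
  rw [hx, inner_smul_left, inner_self_eq_norm_sq_to_K] at this
  simp [← Complex.ofReal_pow] at this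

lemma isSymmetric (h : HasCompactResolvent A c K) : K.IsSymmetric := by
  intro f g
  obtain ⟨x, hx, hx'⟩ := h.right_inv f
  obtain ⟨y, hy, hy'⟩ := h.right_inv g
  have hf : f = A x + (c : ℂ) • (x : H) := by rw [hx', hx]; abel
  have hg : g = A y + (c : ℂ) • (y : H) := by rw [hy', hy]; abel
  simp only [ContinuousLinearMap.coe_coe]
  rw [← hx, ← hy]
  conv_lhs => rw [hg]
  conv_rhs => rw [hf]
  rw [inner_add_left, inner_add_right, inner_smul_left, inner_smul_right, h.symm,
    Complex.conj_ofReal]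

lemma left_inv (h : HasCompactResolvent A c K) (x : A.domain) : K (A x + (c : ℂ) • (x : H)) = x := by
  obtain ⟨z, hz, hz'⟩ := h.right_inv (A x + (c : ℂ) • (x : H))
  have : z - x = 0 := h.eq_zero_of_eigen (by
    rw [LinearPMap.map_sub, hz', ← hz, Submodule.coe_sub]
    module)
  rw [← hz, sub_eq_zero.mp this]

/-- For an eigenvector `x` with eigenvalue `lam`, symmetry gives `⟨x, f⟩ = (lam + c) ⟨x, K f⟩`, and
the factor `lam + c` is nonzero when `x` is. -/
lemma mapsTo (h : HasCompactResolvent A c K) {f : H} (hf : f ∈ (negSpan A)ᗮ) :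
    K f ∈ (negSpan A)ᗮ := by
  refine mem_negSpan_orthogonal fun x lam hlam hx => ?_
  have hw : inner ℂ (x : H) f = 0 := by
    refine (Submodule.mem_orthogonal _ _).1 hf _ (Submodule.subset_span ⟨x, rfl, lam, hlam, hx⟩)
  obtain ⟨z, hz, hz'⟩ := h.right_inv f
  have hf : f = A z + (c : ℂ) • (z : H) := by rw [hz', hz]; abel
  rw [← hz]
  rw [hf, inner_add_right, ← h.symm, hx, inner_smul_left, inner_smul_right, Complex.conj_ofReal,
    ← add_mul, mul_eq_zero] at hw
  rcases hw with hw | hw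
  · have : x = 0 := h.eq_zero_of_eigen (by rw [hx, eq_neg_of_add_eq_zero_left hw])
    simp [this]
  · exact hw

/-- With `f = A y + c y`, one has `y = K f` and `⟨A y, y⟩ = ⟨f - c K f, K f⟩`. The compact symmetric
operator `K` restricts to the orthogonal complement, where only eigenvalues with `c κ² ≤ κ` survive,
so `IsCompactOperator.form_nonneg` applies. -/
lemma form_nonneg_of_mem_orthogonal [CompleteSpace H] (h : HasCompactResolvent A c K)
    (y : A.domain) (hy : (y : H) ∈ (negSpan A)ᗮ) : 0 ≤ (inner ℂ (A y) (y : H)).re := by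
  set U := (negSpan A)ᗮ with hU
  let S : U →L[ℂ] U := K.restrict (fun f hf => h.mapsTo hf)
  have hSapp : ∀ f : U, ((S f : U) : H) = K f := fun f => rfl
  have hSc : IsCompactOperator S := h.compact.restrict' (fun f hf => h.mapsTo hf)
  have hSs : S.IsSymmetric := h.isSymmetric.restrict_invariant (fun f hf => h.mapsTo hf)
  have hev : ∀ (κ : ℝ) (v : U), κ ≠ 0 → v ≠ 0 → S v = (κ : ℂ) • v → 0 ≤ κ - c * κ ^ 2 := by
    intro κ v hne hv0 hv
    have hneC : (κ : ℂ) ≠ 0 := by exact_mod_cast hne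
    have hKv : K (v : H) = (κ : ℂ) • (v : H) := congrArg Subtype.val hv
    obtain ⟨x, hx, hx'⟩ := h.right_inv v
    rw [hKv] at hx hx'
    have hv0' : (v : H) ≠ 0 := by simpa using hv0
    have hx0 : x ≠ 0 := by
      rintro rfl
      simp [hne, hv0, eq_comm] at hx
    have hnv : 0 < ‖(v : H)‖ ^ 2 := by positivity
    -- Eigenvalues `κ` of `K` correspond to eigenvalues `κ⁻¹ - c` of `A`; coercivity then forces `κ
    -- > 0`.
    have hAx : A x = ((κ⁻¹ - c : ℝ) : ℂ) • (x : H) := by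
      rw [hx', hx, smul_smul, smul_smul]
      push_cast
      rw [sub_mul, inv_mul_cancel₀ hneC, sub_smul, one_smul]
    have hp := h.coercive x hx0
    rw [hAx, inner_smul_left, inner_self_eq_norm_sq_to_K] at hp
    have hp' : 0 < (κ⁻¹ - c) * ‖(x : H)‖ ^ 2 + c * ‖(x : H)‖ ^ 2 := by
      convert hp using 2
      simp [← Complex.ofReal_pow]
    have hκpos : 0 < κ := by
      by_contra hcon
      have : κ⁻¹ ≤ 0 := inv_nonpos.2 (not_lt.1 hcon)
      nlinarith [sq_nonneg ‖(x : H)‖]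
    -- Otherwise `x` is an eigenvector of `A` with negative eigenvalue, hence orthogonal to its own
    -- multiple `v`.
    have hle : c ≤ κ⁻¹ := by
      by_contra hcon
      have hmem : (x : H) ∈ negSpan A :=
        Submodule.subset_span ⟨x, rfl, κ⁻¹ - c, by linarith, hAx⟩
      have h2 : inner ℂ (x : H) (v : H) = 0 := (Submodule.mem_orthogonal _ _).1 v.2 _ hmem
      rw [hx, inner_smul_left, mul_eq_zero, inner_self_eq_zero] at h2
      simp [hne, hv0] at h2
    have : c * κ ≤ 1 := by
      have := mul_le_mul_of_nonneg_right hle hκpos.le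
      rwa [inv_mul_cancel₀ hne] at this
    nlinarith
  have hf : A y + (c : ℂ) • (y : H) ∈ U := by
    refine mem_negSpan_orthogonal fun x lam hlam hx => ?_
    have : inner ℂ (x : H) (y : H) = 0 :=
      (Submodule.mem_orthogonal _ _).1 hy _ (Submodule.subset_span ⟨x, rfl, lam, hlam, hx⟩)
    rw [inner_add_right, ← h.symm, hx, inner_smul_left, inner_smul_right, this]
    simp
  have hfin : 0 ≤ (inner ℂ (A y + (c : ℂ) • (y : H) - (c : ℂ) • K (A y + (c : ℂ) • (y : H)))
      (K (A y + (c : ℂ) • (y : H)))).re := IsCompactOperator.form_nonneg hSc hSs c hev ⟨_, hf⟩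
  rwa [h.left_inv, add_sub_cancel_right] at hfin

end HasCompactResolvent
end Abstract

/-! ### The variational characterization of the Morse index -/

section MorseIndex

/-- The quadratic form of `A` is negative definite on the subspace `V` of its domain. -/
def NegDefOn (A : L2 →ₗ.[ℂ] L2) (V : Submodule ℂ L2) : Prop :=
  ∀ y ∈ V, y ≠ 0 → ∃ x : A.domain, (x : L2) = y ∧ (inner ℂ (A x) (x : L2)).re < 0

lemma mem_eigenspace {A : L2 →ₗ.[ℂ] L2} {lam : ℝ} {x : A.domain} :
    x ∈ eigenspace A lam ↔ A x = (lam : ℂ) • (x : L2) := by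
  rw [eigenspace, LinearMap.mem_ker, LinearMap.sub_apply, sub_eq_zero]
  rfl

variable {A : L2 →ₗ.[ℂ] L2} {c : ℝ} {K : L2 →L[ℂ] L2}

/-- The eigenspace embeds into the eigenspace of the compact operator `K` for `(lam + c)⁻¹`; at `lam
= -c` it is trivial. -/
lemma HasCompactResolvent.finiteDimensional_eigenspace (h : HasCompactResolvent A c K) (lam : ℝ) :
    FiniteDimensional ℂ (eigenspace A lam) := by
  by_cases h0 : lam + c = 0
  · have : eigenspace A lam = ⊥ := by
      rw [Submodule.eq_bot_iff]
      intro x hx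
      refine h.eq_zero_of_eigen ?_
      rw [mem_eigenspace.1 hx, eq_neg_of_add_eq_zero_left h0]
      push_cast
      rfl
    rw [this]
    infer_instance
  · have h0C : ((lam + c : ℝ) : ℂ) ≠ 0 := by exact_mod_cast h0
    have : FiniteDimensional ℂ (Module.End.eigenspace K.toLinearMap (((lam + c : ℝ) : ℂ)⁻¹)) :=
      ContinuousLinearMap.finite_dimensional_eigenspace h.compact _ (inv_ne_zero h0C)
    let f : eigenspace A lam →ₗ[ℂ] Module.End.eigenspace K.toLinearMap (((lam + c : ℝ) : ℂ)⁻¹) :=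
      LinearMap.codRestrict _ (A.domain.subtype ∘ₗ (eigenspace A lam).subtype) (by
        intro x
        rw [Module.End.mem_eigenspace_iff]
        have h1 := h.left_inv x.1
        rw [mem_eigenspace.1 x.2, ← add_smul, ← Complex.ofReal_add, map_smul] at h1
        change K (x.1 : L2) = _ • (x.1 : L2)
        rw [eq_inv_smul_iff₀ h0C, h1])
    refine FiniteDimensional.of_injective f fun x y hxy => ?_
    have : ((x.1 : A.domain) : L2) = y.1 := by
      simpa [f] using congrArg Subtype.val hxy
    exact Subtype.ext (Subtype.ext this)

lemma HasCompactResolvent.inner_eigen_eq_zero (h : HasCompactResolvent A c K) {lam lam' : ℝ}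
    (hne : lam ≠ lam') {x y : A.domain} (hx : x ∈ eigenspace A lam) (hy : y ∈ eigenspace A lam') :
    inner ℂ (x : L2) (y : L2) = 0 := by
  have h1 := h.symm x y
  rw [mem_eigenspace.1 hx, mem_eigenspace.1 hy, inner_smul_left, inner_smul_right,
    Complex.conj_ofReal, ← sub_eq_zero, ← sub_mul, mul_eq_zero] at h1
  refine h1.resolve_left ?_
  rw [sub_eq_zero]
  exact_mod_cast hne

/-- The sum map from the product of finitely many eigenspaces to the domain. -/
def eigenSum (A : L2 →ₗ.[ℂ] L2) (s : Finset (Iio (0 : ℝ))) :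
    (∀ i : s, eigenspace A (i.1 : ℝ)) →ₗ[ℂ] A.domain :=
  ∑ i : s, (eigenspace A (i.1 : ℝ)).subtype ∘ₗ LinearMap.proj i

lemma eigenSum_apply (s : Finset (Iio (0 : ℝ))) (v : ∀ i : s, eigenspace A (i.1 : ℝ)) :
    eigenSum A s v = ∑ i : s, (v i : A.domain) := by
  simp [eigenSum, LinearMap.sum_apply]

/-- By orthogonality of distinct eigenspaces the form is diagonal, `∑ lam ‖v_lam‖²`. This also
yields the injectivity of `eigenSum`. -/
lemma HasCompactResolvent.form_eigenSum_neg (h : HasCompactResolvent A c K)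
    (s : Finset (Iio (0 : ℝ))) (v : ∀ i : s, eigenspace A (i.1 : ℝ)) (hv : v ≠ 0) :
    (inner ℂ (A (eigenSum A s v)) (eigenSum A s v : L2)).re < 0 := by
  have h1 : A (eigenSum A s v) = ∑ i : s, ((i.1 : ℝ) : ℂ) • ((v i : A.domain) : L2) := by
    rw [eigenSum_apply]
    change A.toFun _ = _
    rw [map_sum]
    exact Finset.sum_congr rfl fun i _ => mem_eigenspace.1 (v i).2
  have h2 : (inner ℂ (A (eigenSum A s v)) (eigenSum A s v : L2)) =
      ((∑ i : s, (i.1 : ℝ) * ‖((v i : A.domain) : L2)‖ ^ 2 : ℝ) : ℂ) := by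
    rw [h1, sum_inner]
    push_cast
    refine Finset.sum_congr rfl fun i _ => ?_
    rw [eigenSum_apply, AddSubmonoidClass.coe_finsetSum, inner_sum, Finset.sum_eq_single i]
    · rw [inner_smul_left, inner_self_eq_norm_sq_to_K]
      simp
    · intro j _ hj
      rw [inner_smul_left, h.inner_eigen_eq_zero _ (v i).2 (v j).2, mul_zero]
      intro he
      exact hj (Subtype.ext (Subtype.ext he.symm))
    · simp
  rw [h2, Complex.ofReal_re]
  obtain ⟨i, hi⟩ := Function.ne_iff.1 hv
  refine Finset.sum_neg' (fun j _ => ?_) ⟨i, Finset.mem_univ _, ?_⟩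
  · exact mul_nonpos_of_nonpos_of_nonneg (le_of_lt j.1.2) (sq_nonneg _)
  · refine mul_neg_of_neg_of_pos i.1.2 ?_
    have : ((v i : A.domain) : L2) ≠ 0 := by
      simpa using hi
    positivity

lemma HasCompactResolvent.sum_toENat (h : HasCompactResolvent A c K) (s : Finset (Iio (0 : ℝ))) :
    ∑ lam ∈ s, Cardinal.toENat (Module.rank ℂ (eigenspace A lam)) =
      (Module.finrank ℂ (∀ i : s, eigenspace A (i.1 : ℝ)) : ℕ∞) := by
  have := fun lam => h.finiteDimensional_eigenspace lam
  rw [Module.finrank_pi_fintype, Nat.cast_sum, ← Finset.sum_coe_sort]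
  refine Finset.sum_congr rfl fun i _ => ?_
  rw [← Module.finrank_eq_rank, Cardinal.toENat_nat]

lemma HasCompactResolvent.exists_negDefOn (h : HasCompactResolvent A c K)
    (s : Finset (Iio (0 : ℝ))) : ∃ V : Submodule ℂ L2, FiniteDimensional ℂ V ∧ NegDefOn A V ∧
      ∑ lam ∈ s, Cardinal.toENat (Module.rank ℂ (eigenspace A lam)) = Module.finrank ℂ V := by
  have := fun lam => h.finiteDimensional_eigenspace lam
  let φ := A.domain.subtype ∘ₗ eigenSum A s
  have hφ : Function.Injective φ := by
    rw [injective_iff_map_eq_zero]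
    intro v hv
    by_contra hne
    have h1 := h.form_eigenSum_neg s v hne
    have h2 : ((eigenSum A s v : A.domain) : L2) = 0 := hv
    rw [h2, inner_zero_right] at h1
    simp at h1
  refine ⟨LinearMap.range φ, inferInstance, ?_, ?_⟩
  · rintro _ ⟨v, rfl⟩ hne
    exact ⟨eigenSum A s v, rfl, h.form_eigenSum_neg s v (by rintro rfl; simp at hne)⟩
  · rw [h.sum_toENat, LinearMap.finrank_range_of_inj hφ]

/-- The negative subspace bound: a subspace of the domain on which the quadratic form is negative
definite has dimension at most the Morse index. -/
lemma HasCompactResolvent.finrank_le_morseIndex (h : HasCompactResolvent A c K)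
    (V : Submodule ℂ L2) [FiniteDimensional ℂ V] (hV : NegDefOn A V) :
    (Module.finrank ℂ V : ℕ∞) ≤ morseIndex A := by
  have := fun lam => h.finiteDimensional_eigenspace lam
  by_contra! hlt
  -- An index exceeded by a finite dimension is finite, so the supremum is attained at some `s`.
  -- Adding another negative eigenvalue to `s` would increase the sum, so `s` contains them all.
  have htop : morseIndex A < ⊤ := hlt.trans (ENat.natCast_lt_top _)
  obtain ⟨s, hs⟩ := ENat.exists_eq_iSup_of_lt_top htop
  have hout : ∀ lam (hlam : lam ∈ Iio (0 : ℝ)), (⟨lam, hlam⟩ : Iio (0 : ℝ)) ∉ s →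
      eigenspace A lam = ⊥ := by
    intro lam hlam hnot
    by_contra hne
    have h1 : 1 ≤ Cardinal.toENat (Module.rank ℂ (eigenspace A lam)) := by
      rw [← Module.finrank_eq_rank, Cardinal.toENat_nat]
      exact_mod_cast Submodule.one_le_finrank_iff.2 hne
    have h2 : ∑ l ∈ insert ⟨lam, hlam⟩ s, Cardinal.toENat (Module.rank ℂ (eigenspace A l)) ≤
        morseIndex A := le_iSup (fun s : Finset (Iio (0 : ℝ)) =>
          ∑ lam ∈ s, Cardinal.toENat (Module.rank ℂ (eigenspace A lam))) _
    rw [Finset.sum_insert hnot, hs] at h2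
    change _ + morseIndex A ≤ morseIndex A at h2
    lift morseIndex A to ℕ using htop.ne with m
    have h3 : (1 : ℕ∞) + m ≤ m := le_trans (by gcongr) h2
    norm_cast at h3
    omega
  let φ := A.domain.subtype ∘ₗ eigenSum A s
  let W := LinearMap.range φ
  have hW : Module.finrank ℂ W < Module.finrank ℂ V := by
    have h1 : Module.finrank ℂ W ≤ Module.finrank ℂ (∀ i : s, eigenspace A (i.1 : ℝ)) :=
      LinearMap.finrank_range_le φ
    have h2 : morseIndex A = (Module.finrank ℂ (∀ i : s, eigenspace A (i.1 : ℝ)) : ℕ∞) := by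
      rw [← h.sum_toENat, hs]
      rfl
    rw [h2] at hlt
    exact h1.trans_lt (by exact_mod_cast hlt)
  have hneg : negSpan A ≤ W := by
    rw [negSpan, Submodule.span_le]
    rintro w ⟨x, rfl, lam, hlam, hx⟩
    have hxE := mem_eigenspace.2 hx
    by_cases hmem : (⟨lam, hlam⟩ : Iio (0 : ℝ)) ∈ s
    · refine ⟨Pi.single (⟨⟨lam, hlam⟩, hmem⟩ : s) ⟨x, hxE⟩, ?_⟩
      change ((eigenSum A s _ : A.domain) : L2) = x
      rw [eigenSum_apply, Finset.sum_eq_single (⟨⟨lam, hlam⟩, hmem⟩ : s)]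
      · simp
      · intro j _ hj
        rw [Pi.single_eq_of_ne hj]
        rfl
      · simp
    · rw [hout lam hlam hmem, Submodule.mem_bot] at hxE
      rw [hxE]
      exact W.zero_mem
  -- By dimension count the projection of `V` to `W` has a nonzero kernel vector. It is orthogonal
  -- to all negative eigenvectors, yet its form is negative.
  let p : V →ₗ[ℂ] W := W.orthogonalProjectionOnto.toLinearMap ∘ₗ V.subtype
  obtain ⟨y, hyker, hy0⟩ := (Submodule.ne_bot_iff _).1 (LinearMap.ker_ne_bot_of_finrank_lt (f := p) hW)
  obtain ⟨x, hx, hxneg⟩ := hV y y.2 (by simpa using hy0)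
  have hyW : (y : L2) ∈ Wᗮ := by
    rw [← Submodule.orthogonalProjectionOnto_eq_zero_iff]
    exact hyker
  have := h.form_nonneg_of_mem_orthogonal x (by
    rw [hx]
    exact Submodule.orthogonal_le hneg hyW)
  linarith

/-- If the form of `B` is negative wherever that of `A` is, the index of `B` is at least that
of `A`. -/
theorem HasCompactResolvent.morseIndex_le {B : L2 →ₗ.[ℂ] L2} {c' : ℝ} {K' : L2 →L[ℂ] L2}
    (hA : HasCompactResolvent A c K) (hB : HasCompactResolvent B c' K')
    (hAB : ∀ x : A.domain, (inner ℂ (A x) (x : L2)).re < 0 →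
      ∃ y : B.domain, (y : L2) = x ∧ (inner ℂ (B y) (y : L2)).re < 0) :
    morseIndex A ≤ morseIndex B := by
  refine iSup_le fun s => ?_
  obtain ⟨V, hV, hneg, hdim⟩ := hA.exists_negDefOn s
  rw [hdim]
  refine hB.finrank_le_morseIndex V fun y hy hy0 => ?_
  obtain ⟨x, rfl, hx⟩ := hneg y hy hy0
  exact hAB x hx

theorem HasCompactResolvent.form_nonneg (h : HasCompactResolvent A c K) (hA : NonNeg A)
    (x : A.domain) : 0 ≤ (inner ℂ (A x) (x : L2)).re := by
  refine h.form_nonneg_of_mem_orthogonal x (mem_negSpan_orthogonal fun z lam hlam hz => ?_)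
  have := mem_eigenspace.2 hz
  rw [hA lam hlam, Submodule.mem_bot] at this
  simp [this]

end MorseIndex

/-! ### Absolute continuity and integration by parts for vector-valued primitives -/

section IntegrationByParts

variable {F : Type*} [NormedAddCommGroup F] [NormedSpace ℝ F]

lemma _root_.AbsolutelyContinuousOnInterval.of_dist_le {X : Type*} [PseudoMetricSpace X]
    {Φ : ℝ → ℝ} {h : ℝ → X} {a b C : ℝ} (hΦ : AbsolutelyContinuousOnInterval Φ a b)
    (hle : ∀ x ∈ uIcc a b, ∀ y ∈ uIcc a b, dist (h x) (h y) ≤ C * dist (Φ x) (Φ y)) :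
    AbsolutelyContinuousOnInterval h a b := by
  rw [absolutelyContinuousOnInterval_iff] at hΦ ⊢
  intro ε hε
  obtain ⟨δ, hδ, H⟩ := hΦ (ε / (|C| + 1)) (by positivity)
  refine ⟨δ, hδ, fun E hE hlt => ?_⟩
  have h1 := H E hE hlt
  calc ∑ i ∈ Finset.range E.1, dist (h (E.2 i).1) (h (E.2 i).2)
      ≤ ∑ i ∈ Finset.range E.1, (|C| + 1) * dist (Φ (E.2 i).1) (Φ (E.2 i).2) := by
        refine Finset.sum_le_sum fun i hi => ?_
        have hmem := hE.1 i hi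
        refine (hle _ hmem.1 _ hmem.2).trans ?_
        gcongr
        exact (le_abs_self C).trans (by linarith)
    _ < ε := by
        rw [← Finset.mul_sum]
        rw [lt_div_iff₀ (by positivity)] at h1
        linarith

lemma dist_primitive_le {f : ℝ → F} {φ : ℝ → ℝ} {a b x y : ℝ}
    (hf : IntervalIntegrable f volume a b) (hφ : IntervalIntegrable φ volume a b)
    (hle : ∀ t, ‖f t‖ ≤ φ t) (hx : x ∈ uIcc a b) (hy : y ∈ uIcc a b) :
    dist (∫ t in a..x, f t) (∫ t in a..y, f t) ≤ dist (∫ t in a..x, φ t) (∫ t in a..y, φ t) := by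
  have hfx := hf.mono_set (uIcc_subset_uIcc_left hx)
  have hfy := hf.mono_set (uIcc_subset_uIcc_left hy)
  have hφx := hφ.mono_set (uIcc_subset_uIcc_left hx)
  have hφy := hφ.mono_set (uIcc_subset_uIcc_left hy)
  rw [dist_eq_norm, dist_eq_norm, intervalIntegral.integral_interval_sub_left hfx hfy,
    intervalIntegral.integral_interval_sub_left hφx hφy]
  exact intervalIntegral.norm_integral_le_abs_of_norm_le (Filter.Eventually.of_forall hle)
    (hφ.mono_set (uIcc_subset_uIcc hy hx))

/-- The difference of `h` and the primitive of `h'` is absolutely continuous with derivative zero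
almost everywhere, hence constant. The primitive is absolutely continuous by comparison with that of
`‖h'‖`. -/
lemma integral_eq_sub_of_absolutelyContinuous {h h' : ℝ → F} {a b : ℝ} [CompleteSpace F]
    (hh : AbsolutelyContinuousOnInterval h a b) (hi : IntervalIntegrable h' volume a b)
    (hd : ∀ᵐ x, x ∈ uIcc a b → HasDerivAt h (h' x) x) : ∫ x in a..b, h' x = h b - h a := by
  have hk : AbsolutelyContinuousOnInterval (fun x => ∫ t in a..x, h' t) a b :=
    (hi.norm.absolutelyContinuousOnInterval_intervalIntegral left_mem_uIcc).of_dist_le (C := 1)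
      fun x hx y hy => by simpa using dist_primitive_le hi hi.norm (fun _ => le_rfl) hx hy
  obtain ⟨C, hC⟩ := (hh.sub hk).const_of_ae_hasDerivAt_zero (by
    filter_upwards [hd, hi.ae_hasDerivAt_integral] with x h1 h2 h3
    simpa using (h1 h3).sub (h2 h3 a left_mem_uIcc))
  have h1 := hC a left_mem_uIcc
  have h2 := hC b right_mem_uIcc
  simp only [Pi.sub_apply, intervalIntegral.integral_same, sub_zero] at h1 h2
  rw [h1, ← h2]
  abel

lemma intervalIntegrable_inner_left {f g : ℝ → E2} {a b : ℝ} (hf : ContinuousOn f (uIcc a b))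
    (hg : IntervalIntegrable g volume a b) :
    IntervalIntegrable (fun t => inner ℂ (f t) (g t)) volume a b := by
  obtain ⟨C, hC⟩ := isCompact_uIcc.exists_bound_of_continuousOn hf
  rw [intervalIntegrable_iff] at hg ⊢
  have hm : AEStronglyMeasurable f (volume.restrict (uIoc a b)) :=
    (hf.mono uIoc_subset_uIcc).aestronglyMeasurable measurableSet_uIoc
  refine (hg.norm.const_mul C).mono' (hm.inner hg.1) ?_
  filter_upwards [ae_restrict_mem measurableSet_uIoc] with t ht
  refine (norm_inner_le_norm _ _).trans ?_
  gcongr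
  exact hC t (uIoc_subset_uIcc ht)

lemma intervalIntegrable_inner_right {f g : ℝ → E2} {a b : ℝ}
    (hf : IntervalIntegrable f volume a b) (hg : ContinuousOn g (uIcc a b)) :
    IntervalIntegrable (fun t => inner ℂ (f t) (g t)) volume a b := by
  obtain ⟨C, hC⟩ := isCompact_uIcc.exists_bound_of_continuousOn hg
  rw [intervalIntegrable_iff] at hf ⊢
  have hm : AEStronglyMeasurable g (volume.restrict (uIoc a b)) :=
    (hg.mono uIoc_subset_uIcc).aestronglyMeasurable measurableSet_uIoc
  refine (hf.norm.mul_const C).mono' (hf.1.inner hm) ?_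
  filter_upwards [ae_restrict_mem measurableSet_uIoc] with t ht
  refine (norm_inner_le_norm _ _).trans ?_
  gcongr
  exact hC t (uIoc_subset_uIcc ht)

/-- Integration by parts for the inner product of two primitives. -/
lemma integral_inner_add_inner {f f' g g' : ℝ → E2} {b : ℝ} (hb : 0 ≤ b)
    (hf' : IntervalIntegrable f' volume 0 b) (hg' : IntervalIntegrable g' volume 0 b)
    (hf : ∀ t ∈ Icc (0 : ℝ) b, f t = f 0 + ∫ s in (0 : ℝ)..t, f' s)
    (hg : ∀ t ∈ Icc (0 : ℝ) b, g t = g 0 + ∫ s in (0 : ℝ)..t, g' s) :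
    ∫ t in (0 : ℝ)..b, (inner ℂ (f t) (g' t) + inner ℂ (f' t) (g t)) =
      inner ℂ (f b) (g b) - inner ℂ (f 0) (g 0) := by
  -- The functions `f` and `g` are controlled only on `[0, b]`; the primitives `F` and `G` are
  -- defined on all of `ℝ`, so two-sided derivatives make sense at the endpoints too.
  set F : ℝ → E2 := fun t => f 0 + ∫ s in (0 : ℝ)..t, f' s with hF
  set G : ℝ → E2 := fun t => g 0 + ∫ s in (0 : ℝ)..t, g' s with hG
  have hu : uIcc 0 b = Icc 0 b := uIcc_of_le hb
  have hFc : ContinuousOn F (uIcc 0 b) :=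
    continuousOn_const.add (intervalIntegral.continuousOn_primitive_interval' hf' left_mem_uIcc)
  have hGc : ContinuousOn G (uIcc 0 b) :=
    continuousOn_const.add (intervalIntegral.continuousOn_primitive_interval' hg' left_mem_uIcc)
  obtain ⟨CF, hCF⟩ := isCompact_uIcc.exists_bound_of_continuousOn hFc
  obtain ⟨CG, hCG⟩ := isCompact_uIcc.exists_bound_of_continuousOn hGc
  have hac : AbsolutelyContinuousOnInterval (fun t => inner ℂ (F t) (G t)) 0 b := by
    -- Increments of the inner product are dominated by those of the primitive of `‖f'‖ + ‖g'‖`,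
    -- with uniform bounds of `F` and `G` as the constant.
    refine ((hf'.norm.add hg'.norm).absolutelyContinuousOnInterval_intervalIntegral
      left_mem_uIcc).of_dist_le (C := |CF| + |CG|) fun x hx y hy => ?_
    have e1 : dist (F x) (F y) ≤ dist (∫ t in (0 : ℝ)..x, (‖f' t‖ + ‖g' t‖))
        (∫ t in (0 : ℝ)..y, (‖f' t‖ + ‖g' t‖)) := by
      rw [hF, dist_add_left]
      exact dist_primitive_le hf' (hf'.norm.add hg'.norm)
        (fun t => le_add_of_nonneg_right (norm_nonneg _)) hx hy
    have e2 : dist (G x) (G y) ≤ dist (∫ t in (0 : ℝ)..x, (‖f' t‖ + ‖g' t‖))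
        (∫ t in (0 : ℝ)..y, (‖f' t‖ + ‖g' t‖)) := by
      rw [hG, dist_add_left]
      exact dist_primitive_le hg' (hf'.norm.add hg'.norm)
        (fun t => le_add_of_nonneg_left (norm_nonneg _)) hx hy
    have hsplit : inner ℂ (F x) (G x) - inner ℂ (F y) (G y) =
        inner ℂ (F x - F y) (G x) + inner ℂ (F y) (G x - G y) := by
      rw [inner_sub_left, inner_sub_right]
      abel
    rw [dist_eq_norm, hsplit]
    refine (norm_add_le _ _).trans ?_
    refine (add_le_add (norm_inner_le_norm _ _) (norm_inner_le_norm _ _)).trans ?_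
    rw [← dist_eq_norm, ← dist_eq_norm]
    have e3 := (hCF y hy).trans (le_abs_self _)
    have e4 := (hCG x hx).trans (le_abs_self _)
    refine (add_le_add (mul_le_mul e1 e4 (norm_nonneg _) dist_nonneg)
      (mul_le_mul e3 e2 dist_nonneg (abs_nonneg _))).trans (le_of_eq ?_)
    ring
  have hi : IntervalIntegrable (fun t => inner ℂ (F t) (g' t) + inner ℂ (f' t) (G t))
      volume 0 b :=
    (intervalIntegrable_inner_left hFc hg').add (intervalIntegrable_inner_right hf' hGc)
  have key := integral_eq_sub_of_absolutelyContinuous hac hi (by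
    filter_upwards [hf'.ae_hasDerivAt_integral, hg'.ae_hasDerivAt_integral] with x h1 h2 h3
    exact ((h1 h3 0 left_mem_uIcc).const_add _).inner ℂ ((h2 h3 0 left_mem_uIcc).const_add _))
  have hfF : ∀ t ∈ uIcc 0 b, f t = F t := fun t ht => hf t (hu ▸ ht)
  have hgG : ∀ t ∈ uIcc 0 b, g t = G t := fun t ht => hg t (hu ▸ ht)
  rw [hfF _ left_mem_uIcc, hfF _ right_mem_uIcc, hgG _ left_mem_uIcc, hgG _ right_mem_uIcc, ← key]
  refine intervalIntegral.integral_congr fun t ht => ?_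
  simp only [hfF t ht, hgG t ht]

end IntegrationByParts

/-! ### The quadratic form as a square plus terms linear in `α` and `β` -/

section Form

/-- The logarithmic derivative of `1 + e cos θ`. -/
def qE (e θ : ℝ) : ℝ := -(e * Real.sin θ) * rE e θ

lemma one_add_mul_cos_pos {e : ℝ} (he₀ : 0 ≤ e) (he₁ : e < 1) (θ : ℝ) : 0 < 1 + e * Real.cos θ := by
  nlinarith [Real.neg_one_le_cos θ, mul_le_mul_of_nonneg_left (Real.neg_one_le_cos θ) he₀]

lemma continuous_rE {e : ℝ} (he₀ : 0 ≤ e) (he₁ : e < 1) : Continuous (rE e) :=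
  Continuous.inv₀ (by fun_prop) fun θ => (one_add_mul_cos_pos he₀ he₁ θ).ne'

lemma continuous_qE {e : ℝ} (he₀ : 0 ≤ e) (he₁ : e < 1) : Continuous (qE e) :=
  Continuous.mul (by fun_prop) (continuous_rE he₀ he₁)

lemma half_le_rE {e : ℝ} (he₀ : 0 ≤ e) (he₁ : e < 1) (θ : ℝ) : 1 / 2 ≤ rE e θ := by
  rw [rE, one_div]
  refine inv_anti₀ (one_add_mul_cos_pos he₀ he₁ θ) ?_
  nlinarith [Real.cos_le_one θ]

lemma rE_le {e : ℝ} (he₀ : 0 ≤ e) (he₁ : e < 1) (θ : ℝ) : rE e θ ≤ (1 - e)⁻¹ := by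
  refine inv_anti₀ (by linarith) ?_
  nlinarith [Real.neg_one_le_cos θ]

/-- This Riccati equation is what makes the operator at `α = β = 0` factor through `firstOrder`. -/
lemma hasDerivAt_qE {e : ℝ} (he₀ : 0 ≤ e) (he₁ : e < 1) (θ : ℝ) :
    HasDerivAt (qE e) (rE e θ - 1 - qE e θ ^ 2) θ := by
  have h0 := (one_add_mul_cos_pos he₀ he₁ θ).ne'
  have h1 : HasDerivAt (fun θ => 1 + e * Real.cos θ) (e * -Real.sin θ) θ :=
    ((Real.hasDerivAt_cos θ).const_mul e).const_add 1
  have h2 := (((Real.hasDerivAt_sin θ).const_mul e).neg).mul (h1.inv h0)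
  refine h2.congr_deriv ?_
  simp only [qE, rE, Pi.neg_apply, Pi.inv_apply]
  field_simp
  ring

lemma inner_E2 (v w : E2) : inner ℂ v w =
    w 0 * (starRingEnd ℂ) (v 0) + w 1 * (starRingEnd ℂ) (v 1) := by
  simp [PiLp.inner_apply, Fin.sum_univ_two]

lemma act_J2_zero (v : E2) : act J2 v 0 = -v 1 := by
  simp [act, J2, Matrix.ofLp_toEuclideanCLM, Matrix.mulVec, dotProduct, Fin.sum_univ_two]

lemma act_J2_one (v : E2) : act J2 v 1 = v 0 := by
  simp [act, J2, Matrix.ofLp_toEuclideanCLM, Matrix.mulVec, dotProduct, Fin.sum_univ_two]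

lemma act_Rmat_zero (α β : ℝ) (v : E2) : act (Rmat α β) v 0 = (1 + α + β) * v 0 := by
  simp [act, Rmat, N2, Matrix.ofLp_toEuclideanCLM, Matrix.mulVec, dotProduct, Fin.sum_univ_two]
  ring

lemma act_Rmat_one (α β : ℝ) (v : E2) : act (Rmat α β) v 1 = (1 + α - β) * v 1 := by
  simp [act, Rmat, N2, Matrix.ofLp_toEuclideanCLM, Matrix.mulVec, dotProduct, Fin.sum_univ_two]
  ring

/-- The first order operator `ẏ + J₂ y - q y`. -/
def firstOrder (e : ℝ) (y y₁ : ℝ → E2) (t : ℝ) : E2 :=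
  y₁ t + act J2 (y t) - ((qE e t : ℝ) : ℂ) • y t

lemma norm_sq_E2 (v : E2) : ((‖v‖ ^ 2 : ℝ) : ℂ) = inner ℂ v v := by
  rw [inner_self_eq_norm_sq_to_K]
  simp

/-- Completing the square: the three trailing groups are the derivatives of `⟨ẏ, y⟩`, `⟨J₂ y, y⟩`
and `q ⟨y, y⟩`, so they integrate to boundary terms. -/
lemma inner_expr (α β e : ℝ) (y y₁ y₂ : ℝ → E2) (t : ℝ) :
    inner ℂ (expr (Rmat α β) e y y₁ y₂ t) (y t) =
      ((‖firstOrder e y y₁ t‖ ^ 2 + α * (rE e t * ‖y t‖ ^ 2) +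
        β * (rE e t * (‖y t 0‖ ^ 2 - ‖y t 1‖ ^ 2)) : ℝ) : ℂ)
      - (inner ℂ (y₁ t) (y₁ t) + inner ℂ (y₂ t) (y t))
      - (inner ℂ (act J2 (y t)) (y₁ t) + inner ℂ (act J2 (y₁ t)) (y t))
      + (((rE e t - 1 - qE e t ^ 2 : ℝ) : ℂ) * inner ℂ (y t) (y t) +
          ((qE e t : ℝ) : ℂ) * (inner ℂ (y t) (y₁ t) + inner ℂ (y₁ t) (y t))) := by
  have hn : ∀ z : ℂ, ((‖z‖ : ℂ)) ^ 2 = z * (starRingEnd ℂ) z := fun z => by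
    rw [Complex.mul_conj, Complex.normSq_eq_norm_sq]; push_cast; rfl
  have e1 : ∀ v : E2, ((‖v‖ : ℂ)) ^ 2 = inner ℂ v v := fun v => by
    rw [← norm_sq_E2]; push_cast; rfl
  push_cast
  rw [e1, e1, hn, hn]
  simp only [inner_E2, expr, firstOrder, PiLp.add_apply, PiLp.sub_apply, PiLp.neg_apply,
    PiLp.smul_apply, act_J2_zero, act_J2_one, act_Rmat_zero, act_Rmat_one, smul_eq_mul, map_add,
    map_sub, map_neg, map_mul, Complex.conj_ofReal, map_ofNat, map_one]
  ring

lemma IsW22.hasDerivAt {y y₁ y₂ : ℝ → E2} (h : IsW22 y y₁ y₂) {t : ℝ}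
    (ht : t ∈ Ioo 0 (2 * Real.pi)) : HasDerivAt y (y₁ t) t := by
  have hsub : uIcc 0 t ⊆ uIcc 0 (2 * Real.pi) :=
    uIcc_subset_uIcc_left (by rw [uIcc_of_le Real.two_pi_pos.le]; exact Ioo_subset_Icc_self ht)
  have hnhds : Icc 0 (2 * Real.pi) ∈ nhds t := Icc_mem_nhds ht.1 ht.2
  have h1 := intervalIntegral.integral_hasDerivAt_right (h.intervalIntegrable₁.mono_set hsub)
    (h.continuousOn₁.stronglyMeasurableAtFilter_nhdsWithin measurableSet_Icc t |>.filter_mono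
      (by rw [nhdsWithin_eq_nhds.2 hnhds])) (h.continuousOn₁.continuousAt hnhds)
  refine (h1.const_add (y 0)).congr_of_eventuallyEq ?_
  filter_upwards [hnhds] with s hs using h.deriv₀ s hs

lemma inner_smul_smul_of_norm_eq_one {ω : ℂ} (hω : ‖ω‖ = 1) (v w : E2) :
    inner ℂ (ω • v) (ω • w) = inner ℂ v w := by
  rw [inner_smul_left, inner_smul_right, ← mul_assoc, mul_comm _ ω, Complex.mul_conj,
    Complex.normSq_eq_norm_sq, hω]
  simp

variable {ω : ℂ} {y y₁ y₂ : ℝ → E2}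

lemma InDomain.integral_deriv_self (hω : ‖ω‖ = 1) (h : InDomain ω y y₁ y₂) :
    ∫ t in (0 : ℝ)..2 * Real.pi, (inner ℂ (y₁ t) (y₁ t) + inner ℂ (y₂ t) (y t)) = 0 := by
  rw [integral_inner_add_inner Real.two_pi_pos.le h.intervalIntegrable h.intervalIntegrable₁
    h.deriv₁ h.deriv₀, h.bdry₀, h.bdry₁, inner_smul_smul_of_norm_eq_one hω, sub_self]

lemma InDomain.integral_J2 (hω : ‖ω‖ = 1) (h : InDomain ω y y₁ y₂) :
    ∫ t in (0 : ℝ)..2 * Real.pi,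
      (inner ℂ (act J2 (y t)) (y₁ t) + inner ℂ (act J2 (y₁ t)) (y t)) = 0 := by
  have hJ : IntervalIntegrable (fun t => act J2 (y₁ t)) volume 0 (2 * Real.pi) := by
    refine ContinuousOn.intervalIntegrable ?_
    rw [uIcc_of_le Real.two_pi_pos.le]
    exact (Matrix.toEuclideanCLM (𝕜 := ℂ) J2).continuous.comp_continuousOn h.continuousOn₁
  rw [integral_inner_add_inner Real.two_pi_pos.le hJ h.intervalIntegrable₁ ?_ h.deriv₀, h.bdry₀,
    act, map_smul, inner_smul_smul_of_norm_eq_one hω, sub_self]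
  intro t ht
  have hsub : uIcc 0 t ⊆ uIcc 0 (2 * Real.pi) :=
    uIcc_subset_uIcc_left (by rw [uIcc_of_le Real.two_pi_pos.le]; exact ht)
  rw [ContinuousLinearMap.intervalIntegral_comp_comm _ (h.intervalIntegrable₁.mono_set hsub),
    h.deriv₀ t ht, act, map_add]

/-- The boundary values of `q ⟨y, y⟩` vanish since `sin` is zero at `0` and `2π`; no condition on
`ω` enters. -/
lemma InDomain.integral_q {e : ℝ} (he₀ : 0 ≤ e) (he₁ : e < 1) (h : InDomain ω y y₁ y₂) :
    ∫ t in (0 : ℝ)..2 * Real.pi, (((rE e t - 1 - qE e t ^ 2 : ℝ) : ℂ) * inner ℂ (y t) (y t) +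
      ((qE e t : ℝ) : ℂ) * (inner ℂ (y t) (y₁ t) + inner ℂ (y₁ t) (y t))) = 0 := by
  have hq : Continuous fun t => ((qE e t : ℝ) : ℂ) :=
    Complex.continuous_ofReal.comp (continuous_qE he₀ he₁)
  have hr : Continuous fun t => ((rE e t - 1 - qE e t ^ 2 : ℝ) : ℂ) :=
    Complex.continuous_ofReal.comp
      (((continuous_rE he₀ he₁).sub continuous_const).sub ((continuous_qE he₀ he₁).pow 2))
  have c0 := h.continuousOn₀
  have c1 := h.continuousOn₁
  rw [intervalIntegral.integral_eq_sub_of_hasDerivAt_of_le Real.two_pi_pos.le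
    (f := fun t => ((qE e t : ℝ) : ℂ) * inner ℂ (y t) (y t))]
  · simp [qE]
  · exact hq.continuousOn.mul (c0.inner c0)
  · intro t ht
    have hy := h.hasDerivAt ht
    exact (hasDerivAt_qE he₀ he₁ t).ofReal_comp.mul (hy.inner ℂ hy)
  · refine ContinuousOn.intervalIntegrable ?_
    rw [uIcc_of_le Real.two_pi_pos.le]
    exact (hr.continuousOn.mul (c0.inner c0)).add
      (hq.continuousOn.mul ((c0.inner c1).add (c1.inner c0)))

lemma integral_mu_eq {F : Type*} [NormedAddCommGroup F] [NormedSpace ℝ F] (f : ℝ → F) :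
    ∫ t, f t ∂mu = ∫ t in (0 : ℝ)..2 * Real.pi, f t := by
  rw [intervalIntegral.integral_of_le Real.two_pi_pos.le, integral_Icc_eq_integral_Ioc]

lemma InDomain.integral_expr {e : ℝ} (he₀ : 0 ≤ e) (he₁ : e < 1) (hω : ‖ω‖ = 1)
    (h : InDomain ω y y₁ y₂) (α β : ℝ) :
    ∫ t, inner ℂ (expr (Rmat α β) e y y₁ y₂ t) (y t) ∂mu =
      (((∫ t in (0 : ℝ)..2 * Real.pi, ‖firstOrder e y y₁ t‖ ^ 2) +
        α * (∫ t in (0 : ℝ)..2 * Real.pi, rE e t * ‖y t‖ ^ 2) +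
        β * ∫ t in (0 : ℝ)..2 * Real.pi, rE e t * (‖y t 0‖ ^ 2 - ‖y t 1‖ ^ 2) : ℝ) : ℂ) := by
  have hu : uIcc 0 (2 * Real.pi) = Icc 0 (2 * Real.pi) := uIcc_of_le Real.two_pi_pos.le
  have c0 := h.continuousOn₀
  have c1 := h.continuousOn₁
  have hJ := (Matrix.toEuclideanCLM (𝕜 := ℂ) J2).continuous
  have hr := (continuous_rE he₀ he₁).continuousOn (s := Icc 0 (2 * Real.pi))
  have hq := (continuous_qE he₀ he₁).continuousOn (s := Icc 0 (2 * Real.pi))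
  have cc : ∀ i : Fin 2, ContinuousOn (fun t => y t i) (Icc 0 (2 * Real.pi)) := fun i =>
    (EuclideanSpace.proj (𝕜 := ℂ) i).continuous.comp_continuousOn c0
  have hqC : ContinuousOn (fun t => ((qE e t : ℝ) : ℂ)) (Icc 0 (2 * Real.pi)) :=
    Complex.continuous_ofReal.comp_continuousOn hq
  have i1 : IntervalIntegrable (fun t => ‖firstOrder e y y₁ t‖ ^ 2) volume 0 (2 * Real.pi) :=
    ContinuousOn.intervalIntegrable (by
      rw [hu]
      exact (((c1.add (hJ.comp_continuousOn c0)).sub (hqC.smul c0)).norm).pow 2)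
  have i2 : IntervalIntegrable (fun t => rE e t * ‖y t‖ ^ 2) volume 0 (2 * Real.pi) :=
    ContinuousOn.intervalIntegrable (by rw [hu]; exact hr.mul (c0.norm.pow 2))
  have i3 : IntervalIntegrable (fun t => rE e t * (‖y t 0‖ ^ 2 - ‖y t 1‖ ^ 2))
      volume 0 (2 * Real.pi) :=
    ContinuousOn.intervalIntegrable (by
      rw [hu]; exact hr.mul (((cc 0).norm.pow 2).sub ((cc 1).norm.pow 2)))
  have i4 : IntervalIntegrable (fun t => inner ℂ (y₁ t) (y₁ t) + inner ℂ (y₂ t) (y t))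
      volume 0 (2 * Real.pi) :=
    (intervalIntegrable_inner_right h.intervalIntegrable₁ (hu ▸ c1)).add
      (intervalIntegrable_inner_right h.intervalIntegrable (hu ▸ c0))
  have i5 : IntervalIntegrable (fun t => inner ℂ (act J2 (y t)) (y₁ t) +
      inner ℂ (act J2 (y₁ t)) (y t)) volume 0 (2 * Real.pi) :=
    ContinuousOn.intervalIntegrable (by
      rw [hu]
      exact ((hJ.comp_continuousOn c0).inner c1).add ((hJ.comp_continuousOn c1).inner c0))
  have i6 : IntervalIntegrable (fun t => ((rE e t - 1 - qE e t ^ 2 : ℝ) : ℂ) * inner ℂ (y t) (y t) +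
      ((qE e t : ℝ) : ℂ) * (inner ℂ (y t) (y₁ t) + inner ℂ (y₁ t) (y t)))
      volume 0 (2 * Real.pi) :=
    ContinuousOn.intervalIntegrable (by
      rw [hu]
      exact ((Complex.continuous_ofReal.comp_continuousOn
        ((hr.sub continuousOn_const).sub (hq.pow 2))).mul (c0.inner c0)).add
          (hqC.mul ((c0.inner c1).add (c1.inner c0))))
  have i12 := (i1.add (i2.const_mul α)).add (i3.const_mul β)
  have i12C : IntervalIntegrable (fun t => ((‖firstOrder e y y₁ t‖ ^ 2 +
      α * (rE e t * ‖y t‖ ^ 2) + β * (rE e t * (‖y t 0‖ ^ 2 - ‖y t 1‖ ^ 2)) : ℝ) : ℂ))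
      volume 0 (2 * Real.pi) := ⟨i12.1.ofReal, i12.2.ofReal⟩
  simp_rw [integral_mu_eq, inner_expr]
  rw [intervalIntegral.integral_add ((i12C.sub i4).sub i5) i6,
    intervalIntegral.integral_sub (i12C.sub i4) i5, intervalIntegral.integral_sub i12C i4,
    h.integral_deriv_self hω, h.integral_J2 hω, h.integral_q he₀ he₁,
    intervalIntegral.integral_ofReal,
    intervalIntegral.integral_add (i1.add (i2.const_mul α)) (i3.const_mul β),
    intervalIntegral.integral_add i1 (i2.const_mul α), intervalIntegral.integral_const_mul,
    intervalIntegral.integral_const_mul]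
  simp

lemma memLp_of_continuousOn {g : ℝ → E2} (hg : ContinuousOn g (Icc 0 (2 * Real.pi))) :
    MemLp g 2 mu := by
  obtain ⟨C, hC⟩ := isCompact_Icc.exists_bound_of_continuousOn hg
  refine MemLp.of_bound (hg.aestronglyMeasurable measurableSet_Icc) C ?_
  filter_upwards [ae_restrict_mem measurableSet_Icc] with t ht using hC t ht

lemma InDomain.memLp_expr (R : Matrix (Fin 2) (Fin 2) ℂ) {e : ℝ} (he₀ : 0 ≤ e) (he₁ : e < 1)
    (h : InDomain ω y y₁ y₂) : MemLp (expr R e y y₁ y₂) 2 mu := by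
  refine (h.memLp.neg.sub (memLp_of_continuousOn (g := fun t => (2 : ℂ) • act J2 (y₁ t))
    (ContinuousOn.fun_const_smul ?_ _))).add (memLp_of_continuousOn
    (g := fun t => ((rE e t : ℝ) : ℂ) • act R (y t)) (ContinuousOn.fun_smul ?_ ?_))
  · exact (Matrix.toEuclideanCLM (𝕜 := ℂ) J2).continuous.comp_continuousOn h.continuousOn₁
  · exact (Complex.continuous_ofReal.comp (continuous_rE he₀ he₁)).continuousOn
  · exact (Matrix.toEuclideanCLM (𝕜 := ℂ) R).continuous.comp_continuousOn h.continuousOn₀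

lemma InDomain.exists_opR_apply (R : Matrix (Fin 2) (Fin 2) ℂ) {e : ℝ} (he₀ : 0 ≤ e) (he₁ : e < 1)
    (h : InDomain ω y y₁ y₂) {u : L2} (hu : u =ᵐ[mu] y) :
    ∃ x : (opR R e ω).domain, (x : L2) = u ∧ opR R e ω x =ᵐ[mu] expr R e y y₁ y₂ := by
  have hL := h.memLp_expr R he₀ he₁
  have hmem : (u, hL.toLp _) ∈ (opR R e ω).graph := by
    rw [graph_opR]
    exact ⟨y, y₁, y₂, h, hu, hL.coeFn_toLp⟩
  obtain ⟨x, hx, hx'⟩ := (LinearPMap.mem_graph_iff _).1 hmem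
  exact ⟨x, hx, by rw [hx']; exact hL.coeFn_toLp⟩

/-- The quadratic form of `𝒜(α, β, e)` at `u` is `q + α ρ + β σ` with real coefficients that do
not depend on `α` and `β`. -/
lemma InDomain.exists_form_eq {e : ℝ} (he₀ : 0 ≤ e) (he₁ : e < 1) (hω : ‖ω‖ = 1)
    (h : InDomain ω y y₁ y₂) (u : L2) (hu : u =ᵐ[mu] y) :
    ∃ q ρ σ : ℝ, 0 ≤ q ∧ ‖u‖ ^ 2 / 2 ≤ ρ ∧ ρ ≤ (1 - e)⁻¹ * ‖u‖ ^ 2 ∧ |σ| ≤ ρ ∧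
      ∀ (α β : ℝ) (x : (op α β e ω).domain), (x : L2) = u →
        inner ℂ (op α β e ω x) (x : L2) = ((q + α * ρ + β * σ : ℝ) : ℂ) := by
  have hu' : uIcc 0 (2 * Real.pi) = Icc 0 (2 * Real.pi) := uIcc_of_le Real.two_pi_pos.le
  have hpi := Real.two_pi_pos.le
  have c0 := h.continuousOn₀
  have hr := (continuous_rE he₀ he₁).continuousOn (s := Icc 0 (2 * Real.pi))
  have cc : ∀ i : Fin 2, ContinuousOn (fun t => y t i) (Icc 0 (2 * Real.pi)) := fun i =>
    (EuclideanSpace.proj (𝕜 := ℂ) i).continuous.comp_continuousOn c0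
  have i0 : IntervalIntegrable (fun t => ‖y t‖ ^ 2) volume 0 (2 * Real.pi) :=
    ContinuousOn.intervalIntegrable (by rw [hu']; exact c0.norm.pow 2)
  have i2 : IntervalIntegrable (fun t => rE e t * ‖y t‖ ^ 2) volume 0 (2 * Real.pi) :=
    ContinuousOn.intervalIntegrable (by rw [hu']; exact hr.mul (c0.norm.pow 2))
  have i3 : IntervalIntegrable (fun t => rE e t * (‖y t 0‖ ^ 2 - ‖y t 1‖ ^ 2))
      volume 0 (2 * Real.pi) :=
    ContinuousOn.intervalIntegrable (by
      rw [hu']; exact hr.mul (((cc 0).norm.pow 2).sub ((cc 1).norm.pow 2)))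
  have hnorm : ‖u‖ ^ 2 = ∫ t in (0 : ℝ)..2 * Real.pi, ‖y t‖ ^ 2 := by
    have h1 : ((‖u‖ ^ 2 : ℝ) : ℂ) = ((∫ t in (0 : ℝ)..2 * Real.pi, ‖y t‖ ^ 2 : ℝ) : ℂ) := by
      rw [← intervalIntegral.integral_ofReal, ← integral_mu_eq]
      have h2 := inner_self_eq_norm_sq_to_K (𝕜 := ℂ) u
      push_cast
      rw [L2.inner_def] at h2
      refine h2.symm.trans (integral_congr_ae ?_)
      filter_upwards [hu] with t ht
      rw [ht, ← norm_sq_E2]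
      push_cast
      rfl
    exact_mod_cast h1
  have hrpos : ∀ t, 0 < rE e t := fun t => by linarith [half_le_rE he₀ he₁ t]
  have hn2 : ∀ t, ‖y t‖ ^ 2 = ‖y t 0‖ ^ 2 + ‖y t 1‖ ^ 2 := fun t => by
    rw [EuclideanSpace.norm_sq_eq, Fin.sum_univ_two]
  refine ⟨∫ t in (0 : ℝ)..2 * Real.pi, ‖firstOrder e y y₁ t‖ ^ 2,
    ∫ t in (0 : ℝ)..2 * Real.pi, rE e t * ‖y t‖ ^ 2,
    ∫ t in (0 : ℝ)..2 * Real.pi, rE e t * (‖y t 0‖ ^ 2 - ‖y t 1‖ ^ 2), ?_, ?_, ?_, ?_, ?_⟩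
  · exact intervalIntegral.integral_nonneg hpi fun t _ => sq_nonneg _
  · rw [hnorm, ← intervalIntegral.integral_div]
    refine intervalIntegral.integral_mono_on hpi (i0.div_const 2) i2 fun t _ => ?_
    rw [div_eq_mul_one_div, mul_comm]
    exact mul_le_mul_of_nonneg_right (half_le_rE he₀ he₁ t) (sq_nonneg _)
  · rw [hnorm, ← intervalIntegral.integral_const_mul]
    refine intervalIntegral.integral_mono_on hpi i2 (i0.const_mul _) fun t _ => ?_
    exact mul_le_mul_of_nonneg_right (rE_le he₀ he₁ t) (sq_nonneg _)
  · rw [abs_le, ← intervalIntegral.integral_neg]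
    constructor
    · refine intervalIntegral.integral_mono_on hpi i2.neg i3 fun t _ => ?_
      rw [hn2]
      nlinarith [hrpos t, mul_nonneg (hrpos t).le (sq_nonneg ‖y t 0‖)]
    · refine intervalIntegral.integral_mono_on hpi i3 i2 fun t _ => ?_
      rw [hn2]
      nlinarith [hrpos t, mul_nonneg (hrpos t).le (sq_nonneg ‖y t 1‖)]
  · intro α β x hx
    rw [← h.integral_expr he₀ he₁ hω α β]
    obtain ⟨x', hx', hx''⟩ := h.exists_opR_apply (Rmat α β) he₀ he₁ hu
    obtain rfl : x' = x := Subtype.ext (hx'.trans hx.symm)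
    rw [L2.inner_def]
    refine integral_congr_ae ?_
    filter_upwards [hx'', hx ▸ hu] with t h1 h2
    rw [h2, ← h1]
    rfl

end Form

/-! ### Compactness of the Volterra operator on `L²` -/

section Volterra

lemma Lp_intervalIntegrable (f : L2) : IntervalIntegrable f volume 0 (2 * Real.pi) := by
  rw [intervalIntegrable_iff_integrableOn_Icc_of_le Real.two_pi_pos.le]
  exact (Lp.memLp f).integrable (by norm_num)

lemma Lp_intervalIntegrable_of_mem (f : L2) {s t : ℝ} (hs : s ∈ Icc 0 (2 * Real.pi))
    (ht : t ∈ Icc 0 (2 * Real.pi)) : IntervalIntegrable f volume s t := by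
  refine (Lp_intervalIntegrable f).mono_set (uIcc_subset_uIcc ?_ ?_) <;>
  rwa [uIcc_of_le Real.two_pi_pos.le]

lemma zero_mem_Icc_two_pi : (0 : ℝ) ∈ Icc 0 (2 * Real.pi) := ⟨le_rfl, Real.two_pi_pos.le⟩

lemma two_pi_mem_Icc : 2 * Real.pi ∈ Icc 0 (2 * Real.pi) := ⟨Real.two_pi_pos.le, le_rfl⟩

lemma ae_mu_Icc {p : ℝ → Prop} (h : ∀ t ∈ Icc 0 (2 * Real.pi), p t) : ∀ᵐ t ∂mu, p t := by
  filter_upwards [ae_restrict_mem measurableSet_Icc] with t ht using h t ht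

lemma intervalIntegral_congr_mu {f g : ℝ → E2} (h : f =ᵐ[mu] g) {t : ℝ}
    (ht : t ∈ Icc 0 (2 * Real.pi)) : ∫ s in (0 : ℝ)..t, f s = ∫ s in (0 : ℝ)..t, g s := by
  rw [intervalIntegral.integral_of_le ht.1, intervalIntegral.integral_of_le ht.1]
  refine integral_congr_ae (ae_restrict_of_ae_restrict_of_subset ?_ h)
  exact fun s hs => ⟨hs.1.le, hs.2.trans ht.2⟩

/-- Cauchy–Schwarz, pairing `f` with the indicator of the interval times the value `c` of the
integral itself; then `‖c‖` is cancelled. -/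
lemma norm_intervalIntegral_le (f : L2) {s t : ℝ} (hs : s ∈ Icc 0 (2 * Real.pi))
    (ht : t ∈ Icc 0 (2 * Real.pi)) : ‖∫ r in s..t, f r‖ ≤ √|t - s| * ‖f‖ := by
  wlog hst : s ≤ t generalizing s t
  · rw [intervalIntegral.integral_symm, norm_neg, abs_sub_comm]
    exact this ht hs (le_of_not_ge hst)
  have hsub : Ioc s t ⊆ Icc 0 (2 * Real.pi) := fun r hr => ⟨hs.1.trans hr.1.le, hr.2.trans ht.2⟩
  have hres : mu.restrict (Ioc s t) = volume.restrict (Ioc s t) := by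
    rw [Measure.restrict_restrict measurableSet_Ioc, inter_eq_left.2 hsub]
  have hvol : mu (Ioc s t) = ENNReal.ofReal (t - s) := by
    rw [Measure.restrict_apply measurableSet_Ioc, inter_eq_left.2 hsub, Real.volume_Ioc]
  have hfin : mu (Ioc s t) ≠ ⊤ := by rw [hvol]; exact ENNReal.ofReal_ne_top
  set c := ∫ r in s..t, f r with hc
  have h1 := L2.inner_indicatorConstLp_eq_inner_setIntegral ℂ measurableSet_Ioc hfin c f
  rw [hres, ← intervalIntegral.integral_of_le hst, ← hc] at h1
  have h2 := norm_inner_le_norm (𝕜 := ℂ) (indicatorConstLp 2 measurableSet_Ioc hfin c) f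
  rw [h1, norm_indicatorConstLp (by norm_num) (by norm_num), measureReal_def, hvol,
    ENNReal.toReal_ofReal (by linarith), inner_self_eq_norm_sq_to_K] at h2
  rw [abs_of_nonneg (by linarith), Real.sqrt_eq_rpow]
  rcases eq_or_ne ‖c‖ 0 with h0 | h0
  · rw [h0]; positivity
  · have h3 : 0 < ‖c‖ := lt_of_le_of_ne (norm_nonneg _) h0.symm
    refine le_of_mul_le_mul_left ?_ h3
    rw [norm_pow, RCLike.norm_ofReal, abs_norm, ENNReal.toReal_ofNat] at h2
    linarith

/-- The primitive of an `L²` function, as a linear map to the continuous functions. -/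
def primitiveLinear : L2 →ₗ[ℂ] BoundedContinuousFunction (Icc (0 : ℝ) (2 * Real.pi)) E2 where
  toFun f := BoundedContinuousFunction.mkOfCompact ⟨fun t => ∫ s in (0 : ℝ)..t, f s, by
    have := intervalIntegral.continuousOn_primitive_interval' (Lp_intervalIntegrable f)
      left_mem_uIcc
    rw [uIcc_of_le Real.two_pi_pos.le] at this
    exact continuousOn_iff_continuous_domRestrict.1 this⟩
  map_add' f g := by
    ext1 t
    change ∫ s in (0 : ℝ)..t, (f + g : L2) s =
      (∫ s in (0 : ℝ)..t, f s) + ∫ s in (0 : ℝ)..t, g s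
    rw [intervalIntegral_congr_mu (Lp.coeFn_add f g) t.2, ← intervalIntegral.integral_add
      (Lp_intervalIntegrable_of_mem f zero_mem_Icc_two_pi t.2)
      (Lp_intervalIntegrable_of_mem g zero_mem_Icc_two_pi t.2)]
    rfl
  map_smul' c f := by
    ext1 t
    change ∫ s in (0 : ℝ)..t, (c • f : L2) s = c • ∫ s in (0 : ℝ)..t, f s
    rw [intervalIntegral_congr_mu (Lp.coeFn_smul c f) t.2, ← intervalIntegral.integral_smul]
    rfl

/-- The primitive of an `L²` function, as a continuous linear map to the continuous functions. -/
def primitive : L2 →L[ℂ] BoundedContinuousFunction (Icc (0 : ℝ) (2 * Real.pi)) E2 :=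
  primitiveLinear.mkContinuous √(2 * Real.pi) fun f => by
    rw [BoundedContinuousFunction.norm_le (by positivity)]
    intro t
    refine (norm_intervalIntegral_le f zero_mem_Icc_two_pi t.2).trans ?_
    gcongr
    rw [sub_zero, abs_of_nonneg t.2.1]
    exact t.2.2

/-- Arzelà–Ascoli: primitives of the unit ball are uniformly bounded and Hölder continuous of
exponent `1/2`, whence the choice `δ = ε²`. -/
lemma isCompactOperator_primitive : IsCompactOperator primitive := by
  change IsCompactOperator primitive.toLinearMap
  rw [isCompactOperator_iff_isCompact_closure_image_ball (𝕜₁ := ℂ) _ one_pos]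
  refine BoundedContinuousFunction.arzela_ascoli (Metric.closedBall 0 √(2 * Real.pi))
    (isCompact_closedBall _ _) _ ?_ ?_
  · rintro _ t ⟨f, hf, rfl⟩
    rw [mem_closedBall_zero_iff]
    have h1 := norm_intervalIntegral_le f zero_mem_Icc_two_pi t.2
    have hf' : ‖f‖ ≤ 1 := by simpa using (mem_ball_zero_iff.1 hf).le
    refine h1.trans ?_
    calc √|t.1 - 0| * ‖f‖ ≤ √|t.1 - 0| * 1 := by gcongr
      _ ≤ √(2 * Real.pi) := by
        rw [mul_one, sub_zero, abs_of_nonneg t.2.1]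
        exact Real.sqrt_le_sqrt t.2.2
  · refine UniformEquicontinuous.equicontinuous ?_
    rw [Metric.uniformEquicontinuous_iff]
    intro ε hε
    refine ⟨ε ^ 2, by positivity, ?_⟩
    rintro s t hst ⟨_, f, hf, rfl⟩
    have hf' : ‖f‖ ≤ 1 := by simpa using (mem_ball_zero_iff.1 hf).le
    change dist (∫ r in (0 : ℝ)..s, f r) (∫ r in (0 : ℝ)..t, f r) < ε
    rw [dist_eq_norm, intervalIntegral.integral_interval_sub_left
      (Lp_intervalIntegrable_of_mem f zero_mem_Icc_two_pi s.2)
      (Lp_intervalIntegrable_of_mem f zero_mem_Icc_two_pi t.2)]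
    refine (norm_intervalIntegral_le f t.2 s.2).trans_lt ?_
    calc √|s.1 - t.1| * ‖f‖ ≤ √|s.1 - t.1| * 1 := by gcongr
      _ < ε := by
        rw [mul_one, Real.sqrt_lt' hε]
        exact hst

/-- The inclusion of the continuous functions in `L²`. -/
def contToLp : BoundedContinuousFunction (Icc (0 : ℝ) (2 * Real.pi)) E2 →ₗ[ℂ] L2 where
  toFun f := (memLp_of_continuousOn (g := IccExtend Real.two_pi_pos.le f)
    f.continuous.Icc_extend'.continuousOn).toLp _
  map_add' f g := by
    rw [← MemLp.toLp_add]
    rfl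
  map_smul' c f := by
    rw [RingHom.id_apply, ← MemLp.toLp_const_smul]
    rfl

lemma coeFn_contToLp (f : BoundedContinuousFunction (Icc (0 : ℝ) (2 * Real.pi)) E2) :
    contToLp f =ᵐ[mu] IccExtend Real.two_pi_pos.le f :=
  MemLp.coeFn_toLp (memLp_of_continuousOn f.continuous.Icc_extend'.continuousOn)

/-- The inclusion of the continuous functions in `L²`, as a continuous linear map. -/
def contToLpL : BoundedContinuousFunction (Icc (0 : ℝ) (2 * Real.pi)) E2 →L[ℂ] L2 :=
  contToLp.mkContinuous ((mu.real univ) ^ ((2 : ENNReal).toReal⁻¹)) fun f => by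
    refine Lp.norm_le_of_ae_bound (norm_nonneg f) ?_
    filter_upwards [coeFn_contToLp f] with t ht
    rw [ht]
    exact f.norm_coe_le_norm _

/-- The Volterra operator `f ↦ ∫₀ᵗ f` on `L²`. -/
def volterra : L2 →L[ℂ] L2 := contToLpL ∘L primitive

lemma isCompactOperator_volterra : IsCompactOperator volterra :=
  isCompactOperator_primitive.clm_comp contToLpL

lemma coeFn_volterra (f : L2) : volterra f =ᵐ[mu] fun t => ∫ s in (0 : ℝ)..t, f s := by
  have h := coeFn_contToLp (primitive f)
  filter_upwards [h, ae_mu_Icc fun t ht => ht] with t h1 ht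
  change contToLp (primitive f) t = _
  rw [h1, IccExtend_of_mem _ _ ht]
  rfl

/-- Multiplication by a continuous function on `L²`. -/
lemma exists_mulOperator {φ : ℝ → ℂ} (hφ : Continuous φ) :
    ∃ M : L2 →L[ℂ] L2, ∀ f, M f =ᵐ[mu] fun t => φ t • f t := by
  obtain ⟨C, hC⟩ := isCompact_Icc.exists_bound_of_continuousOn
    (hφ.continuousOn (s := Icc 0 (2 * Real.pi)))
  have hbd : ∀ f : L2, ∀ᵐ t ∂mu, ‖φ t • f t‖ ≤ C * ‖f t‖ := fun f => ae_mu_Icc fun t ht => by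
    rw [norm_smul]
    gcongr
    exact hC t ht
  have hm : ∀ f : L2, MemLp (fun t => φ t • f t) 2 mu := fun f =>
    (Lp.memLp f).of_le_mul (hφ.aestronglyMeasurable.smul (Lp.memLp f).1) (hbd f)
  let M : L2 →ₗ[ℂ] L2 :=
    { toFun := fun f => (hm f).toLp _
      map_add' := fun f g => by
        rw [← MemLp.toLp_add]
        refine MemLp.toLp_congr _ _ ?_
        filter_upwards [Lp.coeFn_add f g] with t ht
        simp only [ht, Pi.add_apply, smul_add]
      map_smul' := fun c f => by
        rw [RingHom.id_apply, ← MemLp.toLp_const_smul]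
        refine MemLp.toLp_congr _ _ ?_
        filter_upwards [Lp.coeFn_smul c f] with t ht
        simp only [ht, Pi.smul_apply]
        rw [smul_comm] }
  refine ⟨M.mkContinuous C fun f => ?_, fun f => (hm f).coeFn_toLp⟩
  refine Lp.norm_le_mul_norm_of_ae_le_mul ?_
  filter_upwards [(hm f).coeFn_toLp, hbd f] with t h1 h2
  change ‖(hm f).toLp _ t‖ ≤ _
  rwa [h1]

lemma exists_constOperator {φ : ℝ → ℂ} (hφ : Continuous φ) :
    ∃ M : E2 →L[ℂ] L2, ∀ v, M v =ᵐ[mu] fun t => φ t • v := by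
  have hm : ∀ v : E2, MemLp (fun t => φ t • v) 2 mu := fun v =>
    memLp_of_continuousOn (by fun_prop)
  let M : E2 →ₗ[ℂ] L2 :=
    { toFun := fun v => (hm v).toLp _
      map_add' := fun v w => by
        rw [← MemLp.toLp_add]
        refine MemLp.toLp_congr _ _ (Filter.Eventually.of_forall fun t => ?_)
        simp
      map_smul' := fun c v => by
        rw [RingHom.id_apply, ← MemLp.toLp_const_smul]
        refine MemLp.toLp_congr _ _ (Filter.Eventually.of_forall fun t => ?_)
        simp only [Pi.smul_apply]
        rw [smul_comm] }
  exact ⟨LinearMap.toContinuousLinearMap M, fun v => (hm v).coeFn_toLp⟩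

end Volterra

/-! ### The resolvent, from a Fredholm equation for Cauchy data -/

section Resolvent

/-- The primitive of an `L²` function over the whole interval. -/
def totalIntegral : L2 →L[ℂ] E2 :=
  (BoundedContinuousFunction.evalCLM ℂ ⟨2 * Real.pi, two_pi_mem_Icc⟩) ∘L primitive

lemma totalIntegral_apply (f : L2) : totalIntegral f = ∫ s in (0 : ℝ)..2 * Real.pi, f s := rfl

/-- The function with second derivative `g` and initial values `a`, `b`. -/
def sol (g : L2) (a b : E2) (t : ℝ) : E2 :=
  a + ∫ s in (0 : ℝ)..t, (b + ∫ r in (0 : ℝ)..s, g r)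

/-- The derivative of `sol g a b`. -/
def solDeriv (g : L2) (b : E2) (t : ℝ) : E2 := b + ∫ r in (0 : ℝ)..t, g r

lemma isW22_sol (g : L2) (a b : E2) : IsW22 (sol g a b) (solDeriv g b) g where
  memLp := Lp.memLp g
  deriv₁ t _ := by simp [solDeriv]
  deriv₀ t _ := by simp [sol, solDeriv]

lemma sol_eq (g : L2) (a b : E2) {t : ℝ} (ht : t ∈ Icc 0 (2 * Real.pi)) :
    sol g a b t = a + (t : ℂ) • b + ∫ s in (0 : ℝ)..t, volterra g s := by
  have hc : IntervalIntegrable (fun s => ∫ r in (0 : ℝ)..s, g r) volume 0 (2 * Real.pi) := by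
    refine ContinuousOn.intervalIntegrable ?_
    exact intervalIntegral.continuousOn_primitive_interval' (Lp_intervalIntegrable g) left_mem_uIcc
  have hsub : uIcc 0 t ⊆ uIcc 0 (2 * Real.pi) :=
    uIcc_subset_uIcc_left (by rw [uIcc_of_le Real.two_pi_pos.le]; exact ht)
  rw [sol, intervalIntegral.integral_add intervalIntegrable_const (hc.mono_set hsub),
    intervalIntegral.integral_const, intervalIntegral_congr_mu (coeFn_volterra g) ht, sub_zero,
    Complex.coe_smul, add_assoc]

/-- Recovers the Cauchy data from the `L²` class of `y`: continuity turns vanishing almost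
everywhere into vanishing, and differentiating the primitives passes this on to `y₁` and `y₂`. -/
lemma InDomain.eq_zero {ω : ℂ} {y y₁ y₂ : ℝ → E2} (h : InDomain ω y y₁ y₂) (h0 : y =ᵐ[mu] 0) :
    y 0 = 0 ∧ y₁ 0 = 0 ∧ y₂ =ᵐ[mu] 0 := by
  have key : ∀ {g : ℝ → E2}, ContinuousOn g (Icc 0 (2 * Real.pi)) → g =ᵐ[mu] 0 →
      ∀ t ∈ Icc (0 : ℝ) (2 * Real.pi), g t = 0 := fun hg h =>
    Measure.eqOn_Icc_of_ae_eq volume Real.two_pi_pos.ne h hg continuousOn_const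
  have e0 := key h.continuousOn₀ h0
  have hy1 : y₁ =ᵐ[mu] 0 := ae_zero_of_primitive_zero h.intervalIntegrable₁ fun t ht => by
    have := h.deriv₀ t ht
    rw [e0 t ht, e0 0 zero_mem_Icc_two_pi, zero_add] at this
    exact this.symm
  have e1 := key h.continuousOn₁ hy1
  refine ⟨e0 0 zero_mem_Icc_two_pi, e1 0 zero_mem_Icc_two_pi,
    ae_zero_of_primitive_zero h.intervalIntegrable fun t ht => ?_⟩
  have := h.deriv₁ t ht
  rw [e1 t ht, e1 0 zero_mem_Icc_two_pi, zero_add] at this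
  exact this.symm

/-- The data of a Cauchy problem: the second derivative and the initial values. -/
abbrev Cauchy : Type := L2 × (E2 × E2)

/-- The solution `Y` of the Cauchy problem and the result `B` of the lower order terms. -/
lemma exists_cauchy_operators (R : Matrix (Fin 2) (Fin 2) ℂ) {e : ℝ} (he₀ : 0 ≤ e) (he₁ : e < 1) :
    ∃ Y B : Cauchy →L[ℂ] L2, IsCompactOperator Y ∧ IsCompactOperator B ∧ ∀ p : Cauchy,
      Y p =ᵐ[mu] sol p.1 p.2.1 p.2.2 ∧
      B p - p.1 =ᵐ[mu] expr R e (sol p.1 p.2.1 p.2.2) (solDeriv p.1 p.2.2) p.1 := by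
  obtain ⟨M, hM⟩ := exists_mulOperator (φ := fun t => ((rE e t : ℝ) : ℂ))
    (Complex.continuous_ofReal.comp (continuous_rE he₀ he₁))
  obtain ⟨ι, hι⟩ := exists_constOperator (φ := fun _ => 1) continuous_const
  obtain ⟨τ, hτ⟩ := exists_constOperator (φ := fun t => (t : ℂ)) Complex.continuous_ofReal
  let pg : Cauchy →L[ℂ] L2 := ContinuousLinearMap.fst ℂ _ _
  let pa : Cauchy →L[ℂ] E2 := ContinuousLinearMap.fst ℂ _ _ ∘L ContinuousLinearMap.snd ℂ _ _
  let pb : Cauchy →L[ℂ] E2 := ContinuousLinearMap.snd ℂ _ _ ∘L ContinuousLinearMap.snd ℂ _ _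
  let J : L2 →L[ℂ] L2 := (Matrix.toEuclideanCLM (𝕜 := ℂ) J2).compLpL 2 mu
  let N : L2 →L[ℂ] L2 := (Matrix.toEuclideanCLM (𝕜 := ℂ) R).compLpL 2 mu
  -- The initial values act through the finite-dimensional `E2`, and the second derivative enters
  -- `Y` and `Y₁` only through `volterra`, so both are compact.
  let Y : Cauchy →L[ℂ] L2 := ι ∘L pa + τ ∘L pb + volterra ∘L volterra ∘L pg
  let Y₁ : Cauchy →L[ℂ] L2 := ι ∘L pb + volterra ∘L pg
  have cfin : ∀ (S : E2 →L[ℂ] L2) (p : Cauchy →L[ℂ] E2), IsCompactOperator (S ∘L p) := fun S p =>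
    (isCompactOperator_of_locallyCompactSpace_rng S).comp_clm p
  have cY : IsCompactOperator Y := ((cfin ι pa).add (cfin τ pb)).add
    (isCompactOperator_volterra.comp_clm (volterra ∘L pg))
  have cY₁ : IsCompactOperator Y₁ := (cfin ι pb).add (isCompactOperator_volterra.comp_clm pg)
  let B : Cauchy →L[ℂ] L2 := M ∘L N ∘L Y - (2 : ℂ) • (J ∘L Y₁)
  have hY : ∀ p, Y p =ᵐ[mu] sol p.1 p.2.1 p.2.2 := by
    intro p
    have e1 : Y p = ι p.2.1 + τ p.2.2 + volterra (volterra p.1) := rfl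
    rw [e1]
    filter_upwards [Lp.coeFn_add (ι p.2.1 + τ p.2.2) (volterra (volterra p.1)),
      Lp.coeFn_add (ι p.2.1) (τ p.2.2), hι p.2.1, hτ p.2.2, coeFn_volterra (volterra p.1),
      ae_mu_Icc fun t ht => ht] with t h1 h2 h3 h4 h5 ht
    rw [h1, Pi.add_apply, h2, Pi.add_apply, h3, h4, h5, sol_eq _ _ _ ht, one_smul]
  have hY₁ : ∀ p, Y₁ p =ᵐ[mu] solDeriv p.1 p.2.2 := by
    intro p
    have e1 : Y₁ p = ι p.2.2 + volterra p.1 := rfl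
    rw [e1]
    filter_upwards [Lp.coeFn_add (ι p.2.2) (volterra p.1), hι p.2.2, coeFn_volterra p.1]
      with t h1 h2 h3
    rw [h1, Pi.add_apply, h2, h3, one_smul, solDeriv]
  refine ⟨Y, B, cY, ?_, fun p => ⟨hY p, ?_⟩⟩
  · exact (cY.clm_comp (M ∘L N)).sub ((cY₁.clm_comp J).smul (2 : ℂ))
  · have e1 : B p = M (N (Y p)) - (2 : ℂ) • J (Y₁ p) := rfl
    rw [e1]
    filter_upwards [Lp.coeFn_sub (M (N (Y p)) - (2 : ℂ) • J (Y₁ p)) p.1,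
      Lp.coeFn_sub (M (N (Y p))) ((2 : ℂ) • J (Y₁ p)), Lp.coeFn_smul (2 : ℂ) (J (Y₁ p)),
      hM (N (Y p)), (Matrix.toEuclideanCLM (𝕜 := ℂ) R).coeFn_compLpL (p := 2) (Y p),
      (Matrix.toEuclideanCLM (𝕜 := ℂ) J2).coeFn_compLpL (p := 2) (Y₁ p), hY p, hY₁ p]
      with t h1 h2 h3 h4 h5 h6 h7 h8
    rw [h1, Pi.sub_apply, h2, Pi.sub_apply, h3, Pi.smul_apply, h4, h5, h6, h7, h8, expr]
    abel

/-- If `C` is compact and `1 + C` is injective, then `1 + C` has a bounded right inverse. -/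
lemma IsCompactOperator.exists_right_inverse {X : Type*} [NormedAddCommGroup X] [NormedSpace ℂ X]
    [CompleteSpace X] {C : X →L[ℂ] X} (hC : IsCompactOperator C)
    (hker : ∀ p, p + C p = 0 → p = 0) : ∃ T : X →L[ℂ] X, ∀ p, T p + C (T p) = p := by
  -- Fredholm alternative at the nonzero point `-1`.
  have h1 : (-1 : ℂ) ∈ resolventSet ℂ C := by
    refine (hC.hasEigenvalue_or_mem_resolventSet (neg_ne_zero.2 one_ne_zero)).resolve_left ?_
    intro hev
    obtain ⟨v, hv, hv0⟩ := hev.exists_hasEigenvector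
    rw [Module.End.mem_genEigenspace_one] at hv
    have hv' : C v = (-1 : ℂ) • v := hv
    exact hv0 (hker v (by rw [hv', neg_one_smul, add_neg_cancel]))
  have h2 : -(algebraMap ℂ (X →L[ℂ] X) (-1) - C) = 1 + C := by
    rw [map_neg, map_one]
    abel
  rw [spectrum.mem_resolventSet_iff, ← IsUnit.neg_iff, h2] at h1
  obtain ⟨T, hT⟩ := h1.exists_right_inv
  refine ⟨T, fun p => ?_⟩
  have := congrArg (fun S : X →L[ℂ] X => S p) hT
  simpa using this

variable {ω : ℂ} {e : ℝ}

/-- If `A + c > 0`, then `A + c` has a compact right inverse. -/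
lemma exists_resolvent (R : Matrix (Fin 2) (Fin 2) ℂ) (he₀ : 0 ≤ e) (he₁ : e < 1) (c : ℝ)
    (hinj : ∀ x : (opR R e ω).domain, opR R e ω x = -(c : ℂ) • (x : L2) → x = 0) :
    ∃ K : L2 →L[ℂ] L2, IsCompactOperator K ∧
      ∀ f, ∃ x : (opR R e ω).domain, (x : L2) = K f ∧ opR R e ω x = f - (c : ℂ) • K f := by
  obtain ⟨Y, B, cY, cB, hYB⟩ := exists_cauchy_operators R he₀ he₁
  let pg : Cauchy →L[ℂ] L2 := ContinuousLinearMap.fst ℂ _ _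
  let pa : Cauchy →L[ℂ] E2 := ContinuousLinearMap.fst ℂ _ _ ∘L ContinuousLinearMap.snd ℂ _ _
  let pb : Cauchy →L[ℂ] E2 := ContinuousLinearMap.snd ℂ _ _ ∘L ContinuousLinearMap.snd ℂ _ _
  let β₀ : Cauchy →L[ℂ] E2 := (2 * Real.pi : ℂ) • pb + totalIntegral ∘L volterra ∘L pg - ω • pa
  let β₁ : Cauchy →L[ℂ] E2 := totalIntegral ∘L pg - ω • pb
  -- Chosen so that `p + C p` has first component minus `(𝒜 + c) y`, written out as a differential
  -- expression, and remaining components the boundary defects `y(2π) - ω y(0)` and `ẏ(2π) - ω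
  -- ẏ(0)`. The `-y₂` term supplies the identity.
  let C : Cauchy →L[ℂ] Cauchy :=
    ContinuousLinearMap.inl ℂ L2 (E2 × E2) ∘L (-(B + (c : ℂ) • Y)) +
      ContinuousLinearMap.inr ℂ L2 (E2 × E2) ∘L (β₀.prod β₁)
  have cC : IsCompactOperator C := by
    have h1 : IsCompactOperator (-(B + (c : ℂ) • Y)) := (cB.add (cY.smul (c : ℂ))).neg
    have h2 : IsCompactOperator (β₀.prod β₁) := isCompactOperator_of_locallyCompactSpace_dom _
    exact (h1.clm_comp (ContinuousLinearMap.inl ℂ L2 (E2 × E2))).add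
      (h2.clm_comp (ContinuousLinearMap.inr ℂ L2 (E2 × E2)))
  have hC1 : ∀ p, (p + C p).1 = -(B p - p.1 + (c : ℂ) • Y p) := by
    intro p
    have : (C p).1 = -(B p + (c : ℂ) • Y p) + 0 := rfl
    rw [Prod.fst_add, this]
    abel
  have hC2 : ∀ p, (p + C p).2.1 = sol p.1 p.2.1 p.2.2 (2 * Real.pi) - ω • sol p.1 p.2.1 p.2.2 0 := by
    intro p
    have : (C p).2.1 = 0 + ((2 * Real.pi : ℂ) • p.2.2 + totalIntegral (volterra p.1) - ω • p.2.1) :=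
      rfl
    rw [Prod.snd_add, Prod.fst_add, this, sol_eq _ _ _ two_pi_mem_Icc,
      sol_eq _ _ _ zero_mem_Icc_two_pi, totalIntegral_apply]
    simp
    abel
  have hC3 : ∀ p, (p + C p).2.2 = solDeriv p.1 p.2.2 (2 * Real.pi) - ω • solDeriv p.1 p.2.2 0 := by
    intro p
    have : (C p).2.2 = 0 + (totalIntegral p.1 - ω • p.2.2) := rfl
    rw [Prod.snd_add, Prod.snd_add, this, totalIntegral_apply]
    simp [solDeriv]
    abel
  have hdom : ∀ p, (p + C p).2 = 0 → ∃ x : (opR R e ω).domain, (x : L2) = Y p ∧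
      opR R e ω x = B p - p.1 ∧ InDomain ω (sol p.1 p.2.1 p.2.2) (solDeriv p.1 p.2.2) p.1 := by
    intro p hp
    have hin : InDomain ω (sol p.1 p.2.1 p.2.2) (solDeriv p.1 p.2.2) p.1 :=
      { isW22_sol p.1 p.2.1 p.2.2 with
        bdry₀ := by rw [← sub_eq_zero, ← hC2, hp]; rfl
        bdry₁ := by rw [← sub_eq_zero, ← hC3, hp]; rfl }
    obtain ⟨x, hx, hx'⟩ := hin.exists_opR_apply R he₀ he₁ (hYB p).1
    exact ⟨x, hx, Lp.ext (hx'.trans (hYB p).2.symm), hin⟩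
  have hker : ∀ p, p + C p = 0 → p = 0 := by
    intro p hp
    obtain ⟨x, hx, hx', hin⟩ := hdom p (by rw [hp]; rfl)
    have h1 : B p - p.1 + (c : ℂ) • Y p = 0 := by
      rw [← neg_eq_zero, ← hC1, hp]
      rfl
    have h2 : x = 0 := hinj x (by rw [hx', hx, neg_smul, eq_neg_iff_add_eq_zero, h1])
    have h3 : Y p = 0 := by rw [← hx, h2]; rfl
    have h4 : sol p.1 p.2.1 p.2.2 =ᵐ[mu] 0 := by
      refine (hYB p).1.symm.trans ?_
      rw [h3]
      exact Lp.coeFn_zero _ _ _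
    obtain ⟨ha, hb, hg⟩ := hin.eq_zero h4
    refine Prod.ext (Lp.ext (hg.trans (Lp.coeFn_zero _ _ _).symm)) (Prod.ext ?_ ?_)
    · simpa [sol] using ha
    · simpa [solDeriv] using hb
  obtain ⟨T, hT'⟩ := IsCompactOperator.exists_right_inverse cC hker
  refine ⟨Y ∘L T ∘L ContinuousLinearMap.inl ℂ L2 (E2 × E2) ∘L (-ContinuousLinearMap.id ℂ L2),
    cY.comp_clm _, fun f => ?_⟩
  -- Zero boundary defects put the solution in the domain; the sign in `-f` matches that of the
  -- first component.
  obtain ⟨x, hx, hx', -⟩ := hdom (T (-f, 0)) (by rw [hT'])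
  refine ⟨x, hx, ?_⟩
  have h1 := hC1 (T (-f, 0))
  rw [hT', neg_inj] at h1
  rw [hx']
  exact eq_sub_of_add_eq h1.symm

end Resolvent

/-! ### Compact resolvent for the criteria operator, and the conclusion -/

section Main

variable {ω : ℂ} {e : ℝ}

lemma exists_form_eq (he₀ : 0 ≤ e) (he₁ : e < 1) (hω : ‖ω‖ = 1) {α₀ β₀ : ℝ}
    (x₀ : (op α₀ β₀ e ω).domain) :
    ∃ q ρ σ : ℝ, 0 ≤ q ∧ ‖(x₀ : L2)‖ ^ 2 / 2 ≤ ρ ∧ ρ ≤ (1 - e)⁻¹ * ‖(x₀ : L2)‖ ^ 2 ∧ |σ| ≤ ρ ∧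
      ∀ (α β : ℝ) (x : (op α β e ω).domain), (x : L2) = x₀ →
        inner ℂ (op α β e ω x) (x : L2) = ((q + α * ρ + β * σ : ℝ) : ℂ) := by
  obtain ⟨y, y₁, y₂, h, hu⟩ := (mem_domain_opR _ he₀ he₁ ω _).1 x₀.2
  exact h.exists_form_eq he₀ he₁ hω x₀ hu

lemma mem_domain_op (he₀ : 0 ≤ e) (he₁ : e < 1) {α β α' β' : ℝ} (x : (op α β e ω).domain) :
    ∃ x' : (op α' β' e ω).domain, (x' : L2) = x :=
  ⟨⟨x, (mem_domain_opR _ he₀ he₁ ω _).2 ((mem_domain_opR _ he₀ he₁ ω _).1 x.2)⟩, rfl⟩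

/-- A partially defined operator with real quadratic form is symmetric. -/
lemma LinearPMap.symm_of_form_real {H : Type*} [NormedAddCommGroup H] [InnerProductSpace ℂ H]
    (A : H →ₗ.[ℂ] H) (hA : ∀ x : A.domain, (inner ℂ (A x) (x : H)).im = 0) (x y : A.domain) :
    inner ℂ (A x) (y : H) = inner ℂ (x : H) (A y) := by
  -- Polarization: reality of the form at `x + y` and at `x + i y` gives the imaginary and the real
  -- part of the symmetry relation.
  have h1 := hA (x + y)
  have h2 := hA (x + Complex.I • y)
  have hx := hA x
  have hy := hA y
  simp only [LinearPMap.map_add, LinearPMap.map_smul, Submodule.coe_add, Submodule.coe_smul,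
    inner_add_left, inner_add_right, inner_smul_left, inner_smul_right] at h1 h2
  rw [← inner_conj_symm (x : H) (A y)]
  simp only [Complex.add_im, Complex.add_re, Complex.mul_im, Complex.mul_re, Complex.conj_I, Complex.neg_im,
    Complex.neg_re, Complex.I_re, Complex.I_im, hx, hy] at h1 h2
  refine Complex.ext ?_ ?_
  · rw [Complex.conj_re]; linarith
  · rw [Complex.conj_im]; linarith

theorem exists_hasCompactResolvent (he₀ : 0 ≤ e) (he₁ : e < 1) (hω : ‖ω‖ = 1) {α β : ℝ}
    (hα : 0 ≤ α) (hβ : 0 ≤ β) : ∃ c K, HasCompactResolvent (op α β e ω) c K := by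
  have hinv : 0 < (1 - e)⁻¹ := inv_pos.2 (by linarith)
  -- The only possibly negative term satisfies `β σ ≥ -β (1 - e)⁻¹ ‖x‖²`; the extra `1` makes
  -- coercivity strict.
  set c : ℝ := β * (1 - e)⁻¹ + 1 with hc
  have hc0 : 0 < c := by positivity
  have hcoer : ∀ x : (op α β e ω).domain, x ≠ 0 →
      0 < (inner ℂ (op α β e ω x) (x : L2)).re + c * ‖(x : L2)‖ ^ 2 := by
    intro x hx
    obtain ⟨q, ρ, σ, hq, hρ, hρ', hσ, hf⟩ := exists_form_eq he₀ he₁ hω x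
    rw [hf α β x rfl, Complex.ofReal_re]
    have hn : 0 < ‖(x : L2)‖ ^ 2 := by
      have : (x : L2) ≠ 0 := by simpa using hx
      positivity
    have hρ0 : 0 ≤ ρ := by linarith
    have h1 : -(β * ((1 - e)⁻¹ * ‖(x : L2)‖ ^ 2)) ≤ β * σ := by
      rw [← mul_neg]
      exact mul_le_mul_of_nonneg_left (by linarith [(abs_le.1 hσ).1]) hβ
    have h2 : 0 ≤ α * ρ := by positivity
    rw [hc]
    nlinarith
  obtain ⟨K, hK, hK'⟩ := exists_resolvent (ω := ω) (Rmat α β) he₀ he₁ c (by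
    intro x hx
    by_contra hne
    have := hcoer x hne
    change op α β e ω x = _ at hx
    rw [hx, inner_smul_left, inner_self_eq_norm_sq_to_K] at this
    simp [← Complex.ofReal_pow] at this)
  refine ⟨c, K, LinearPMap.symm_of_form_real _ fun x => ?_, hc0, hcoer, hK, hK'⟩
  obtain ⟨q, ρ, σ, -, -, -, -, hf⟩ := exists_form_eq he₀ he₁ hω x
  rw [hf α β x rfl, Complex.ofReal_im]

end Main
end CriteriaOperator
end

open CriteriaOperator in
theorem proposition3p2 (ω : ℂ) (hω : ‖ω‖ = 1) (e : ℝ) (he₀ : 0 ≤ e) (he₁ : e < 1) :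
    (∀ β : ℝ, 0 ≤ β → AntitoneOn (fun α : ℝ => morseIndex (op α β e ω)) (Set.Ici 0)) ∧
    (∀ α : ℝ, 0 ≤ α → MonotoneOn (fun β : ℝ => morseIndex (op α β e ω)) (Set.Ioi 0)) ∧
    (∀ α β₁ β₂ : ℝ, 0 < α → 0 < β₁ → β₁ < β₂ →
      NonNeg (op α β₂ e ω) → PosDef (op α β₁ e ω)) := by
  refine ⟨fun β hβ α₁ hα₁ α₂ hα₂ hle => ?_, fun α hα β₁ hβ₁ β₂ hβ₂ hle => ?_,
    fun α β₁ β₂ hα hβ₁ hlt hnn x hx => ?_⟩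
  · obtain ⟨c₁, K₁, h₁⟩ := exists_hasCompactResolvent he₀ he₁ hω hα₁ hβ
    obtain ⟨c₂, K₂, h₂⟩ := exists_hasCompactResolvent he₀ he₁ hω hα₂ hβ
    refine h₂.morseIndex_le h₁ fun x hx => ?_
    obtain ⟨x', hx'⟩ := mem_domain_op he₀ he₁ (α' := α₁) (β' := β) x
    obtain ⟨q, ρ, σ, hq, hρ, hρ', hσ, hf⟩ := exists_form_eq he₀ he₁ hω x
    refine ⟨x', hx', ?_⟩
    rw [hf _ _ x rfl, Complex.ofReal_re] at hx
    rw [hf _ _ x' hx', Complex.ofReal_re]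
    have : α₁ * ρ ≤ α₂ * ρ :=
      mul_le_mul_of_nonneg_right hle ((abs_nonneg σ).trans hσ)
    linarith
  · obtain ⟨c₁, K₁, h₁⟩ := exists_hasCompactResolvent he₀ he₁ hω hα (le_of_lt hβ₁)
    obtain ⟨c₂, K₂, h₂⟩ := exists_hasCompactResolvent he₀ he₁ hω hα (le_of_lt hβ₂)
    refine h₁.morseIndex_le h₂ fun x hx => ?_
    obtain ⟨x', hx'⟩ := mem_domain_op he₀ he₁ (α' := α) (β' := β₂) x
    obtain ⟨q, ρ, σ, hq, hρ, hρ', hσ, hf⟩ := exists_form_eq he₀ he₁ hω x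
    refine ⟨x', hx', ?_⟩
    rw [hf _ _ x rfl, Complex.ofReal_re] at hx
    rw [hf _ _ x' hx', Complex.ofReal_re]
    have hαρ : 0 ≤ α * ρ := mul_nonneg hα ((abs_nonneg σ).trans hσ)
    have hβ₁' : 0 < β₁ := hβ₁
    -- Since `q + α ρ ≥ 0`, a negative form forces `β₁ σ < 0`.
    have hσneg : σ < 0 := by
      by_contra hcon
      have := mul_nonneg hβ₁'.le (not_lt.1 hcon)
      linarith
    have := mul_le_mul_of_nonpos_right hle hσneg.le
    linarith
  · have hβ₂ : 0 < β₂ := hβ₁.trans hlt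
    obtain ⟨c₂, K₂, h₂⟩ := exists_hasCompactResolvent he₀ he₁ hω hα.le hβ₂.le
    obtain ⟨x', hx'⟩ := mem_domain_op he₀ he₁ (α' := α) (β' := β₂) x
    obtain ⟨q, ρ, σ, hq, hρ, hρ', hσ, hf⟩ := exists_form_eq he₀ he₁ hω x
    have hform := h₂.form_nonneg hnn x'
    rw [hf _ _ x' hx', Complex.ofReal_re] at hform
    rw [hf _ _ x rfl, Complex.ofReal_re, Complex.ofReal_im]
    refine ⟨?_, rfl⟩
    have hn : 0 < ‖(x : L2)‖ ^ 2 := by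
      have : (x : L2) ≠ 0 := by simpa using hx
      positivity
    have hαρ : 0 < α * ρ := mul_pos hα (by linarith)
    -- For `σ ≥ 0` strictness comes from `α ρ > 0`; for `σ < 0` it comes from `β₁ < β₂` and
    -- nonnegativity at `β₂`.
    rcases le_or_gt 0 σ with hσ0 | hσ0
    · have := mul_nonneg hβ₁.le hσ0
      linarith
    · have := mul_lt_mul_of_neg_right hlt hσ0
      linarith
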